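/- Let $X$ be a compact connected Riemann surface of genus $g\ge 2$ with canonical bundle $K$, let $d$ be an integer with $|d|<g-1$, and let $q\in H^0(X,K^2)$ be a quadratic differential all of whose zeros are simple; let $D=\{x_1,\dots,x_{4g-4}\}$ be its zero set. An $SU(1,2)$ Higgs bundle on $X$ is a triple $(F,\beta,\gamma)$ of a holomorphic vector bundle $F$ of rank two and holomorphic maps $\beta:\Lambda^2F^*\otimes K^{-1}\to F$, $\gamma:F\to\Lambda^2F^*\otimes K$. An isomorphism $(F,\beta,\gamma)\sim(F',\beta',\gamma')$ is an isomorphism $\alpha:F\to F'$ with $\alpha\circ\beta=\beta'\circ((\Lambda^2\alpha)^{-t}\otimes 1)$ and $\gamma'\circ\alpha=((\Lambda^2\alpha)^{-t}\otimes 1)\circ\gamma$. For every $p\in\mathrm{Pic}^d X$ let $L_p$ be a holomorphic line bundle in the class $p$ (for instance the restriction to $X\times\{p\}$ of a fixed Poincaré bundle), and let $V_p=L_p^{-2}K\oplus L_pK$. Let $\mathcal P$ be the set of pairs $(p,\underline\ell)$ with $p\in\mathrm{Pic}^dX$ and $\underline\ell=(\ell_1,\dots,\ell_{4g-4})$, where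 $\ell_j$ is a line in $(V_p)_{x_j}^*$. Write $[x_0:x_1]$ for homogeneous coordinates on $\mathbb P((V_p)^*_{x_j})$ adapted to the decomposition $(V_p)^*_{x_j}=(L_p^{-2}K)^*_{x_j}\oplus (L_pK)^*_{x_j}$; thus $[0:1]$ is the line of functionals vanishing on $L_p^{-2}K$, and $[1:0]$ the line of functionals vanishing on $L_pK$. Let $n_1(\underline\ell)$ and $n_2(\underline\ell)$ be the numbers of indices $j$ with $\ell_j=[0:1]$ and $\ell_j=[1:0]$ respectively, and let $$\mathcal Y=\{(p,\underline\ell)\in\mathcal P : n_1(\underline\ell)<2(g-1+d),\ n_2(\underline\ell)<2(g-1-d)\}.$$ The group $\mathbb C^\times$ acts on $\mathcal P$ and on $\mathcal Y$ by $c\cdot(p,(\ell_j)_j)=(p,(c\,\ell_j)_j)$, where $c\,[x_0:x_1]=[c\,x_0:x_1]$. For $y=(p,\underline\ell)\in\mathcal Y$ put $L=L_p$, $V=V_p$, and let $\varepsilon=\varepsilon_1\oplus\varepsilon_2:\mathcal F_y\to V=L^{-2}K\oplus LK$ be the inclusion of the rank two bundle $\mathcal F_y$ of those sections of $V$ whose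 value at each $x_j$ is annihilated by $\ell_j$. Identify $\Lambda^2\mathcal F_y=L^{-1}$ by the isomorphism for which $\Lambda^2\varepsilon:L^{-1}\to\Lambda^2V=L^{-1}K^2$ is multiplication by $q$. Let $\gamma_y=\varepsilon_2:\mathcal F_y\to LK=\Lambda^2\mathcal F_y^*\otimes K$, and let $\beta_y:LK^{-1}=L^{2}K^{-1}\otimes L^{-1}\to\mathcal F_y^*\otimes\Lambda^2\mathcal F_y\to\mathcal F_y$ be the composition of $-\varepsilon_1^t\otimes 1$ with the canonical isomorphism $h\otimes s_1\wedge s_2\mapsto h(s_2)s_1-h(s_1)s_2$. Then $(\mathcal F_y,\beta_y,\gamma_y)$ is an $SU(1,2)$ Higgs bundle, and for all $s,t\in\mathcal Y$: $$(\mathcal F_s,\beta_s,\gamma_s)\sim(\mathcal F_t,\beta_t,\gamma_t)\iff s \text{ and } t \text{ lie in the same } \mathbb C^\times\text{-orbit}.$$ -/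

import Mathlib

open Set Filter Topology Bundle
open scoped Manifold ContDiff LinearAlgebra.Projectivization

noncomputable section

namespace SU12

/-- A holomorphic vector bundle with model fibre `E` over a complex manifold modelled on `ℂ`. -/
structure HolVB (X : Type*) [TopologicalSpace X] [ChartedSpace ℂ X]
    (E : Type) [NormedAddCommGroup E] [NormedSpace ℂ E] where
  Fiber : X → Type
  [addCommGroup : ∀ x, AddCommGroup (Fiber x)]
  [module : ∀ x, Module ℂ (Fiber x)]
  [topFiber : ∀ x, TopologicalSpace (Fiber x)]
  [topTotal : TopologicalSpace (TotalSpace E Fiber)]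
  [fiberBundle : FiberBundle E Fiber]
  [vectorBundle : VectorBundle ℂ E Fiber]
  [holomorphic : ContMDiffVectorBundle ω E Fiber 𝓘(ℂ)]

attribute [instance] HolVB.addCommGroup HolVB.module HolVB.topFiber HolVB.topTotal
  HolVB.fiberBundle HolVB.vectorBundle HolVB.holomorphic

section Bundles

variable {X : Type*} [TopologicalSpace X] [ChartedSpace ℂ X]
variable {E : Type} [NormedAddCommGroup E] [NormedSpace ℂ E]

/-- The preferred local trivialisation of `V` around `k`. -/
def HolVB.triv (V : HolVB X E) (k : X) : Trivialization E (π E V.Fiber) :=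
  trivializationAt E V.Fiber k

/-- The open set on which the preferred trivialisation around `k` is defined. -/
def HolVB.base (V : HolVB X E) (k : X) : Set X := (V.triv k).baseSet

instance (V : HolVB X E) (k : X) : MemTrivializationAtlas (V.triv k) :=
  inferInstanceAs (MemTrivializationAtlas (trivializationAt E V.Fiber k))

/-- Linear coordinate `V_p → E` given by the trivialisation around `k`. -/
def HolVB.coord (V : HolVB X E) (k p : X) : V.Fiber p →ₗ[ℂ] E := (V.triv k).linearMapAt ℂ p

/-- The local section of `V` around `k` with constant coordinate `v`. -/
def HolVB.localSec (V : HolVB X E) (k p : X) (v : E) : V.Fiber p := (V.triv k).symm p v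

/-- An isomorphism of holomorphic vector bundles: fibrewise linear isomorphisms such that the map
of total spaces and its inverse are holomorphic. -/
structure HolVB.Iso (V W : HolVB X E) where
  toEquiv : ∀ x, V.Fiber x ≃ₗ[ℂ] W.Fiber x
  hol : ContMDiff (𝓘(ℂ).prod 𝓘(ℂ, E)) (𝓘(ℂ).prod 𝓘(ℂ, E)) ω
    (fun v : TotalSpace E V.Fiber => (⟨v.1, toEquiv v.1 v.2⟩ : TotalSpace E W.Fiber))
  hol_symm : ContMDiff (𝓘(ℂ).prod 𝓘(ℂ, E)) (𝓘(ℂ).prod 𝓘(ℂ, E)) ω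
    (fun w : TotalSpace E W.Fiber => (⟨w.1, (toEquiv w.1).symm w.2⟩ : TotalSpace E V.Fiber))

def HolVB.Iso.refl (V : HolVB X E) : V.Iso V where
  toEquiv _ := LinearEquiv.refl ℂ _
  hol := contMDiff_id
  hol_symm := contMDiff_id

def HolVB.Iso.symm {V W : HolVB X E} (a : V.Iso W) : W.Iso V where
  toEquiv x := (a.toEquiv x).symm
  hol := a.hol_symm
  hol_symm := a.hol

def HolVB.Iso.trans {V W Z : HolVB X E} (a : V.Iso W) (b : W.Iso Z) : V.Iso Z where
  toEquiv x := (a.toEquiv x).trans (b.toEquiv x)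
  hol := b.hol.comp a.hol
  hol_symm := a.hol_symm.comp b.hol_symm

instance HolVB.setoid : Setoid (HolVB X E) where
  r V W := Nonempty (V.Iso W)
  iseqv := ⟨fun V => ⟨.refl V⟩, fun ⟨a⟩ => ⟨a.symm⟩, fun ⟨a⟩ ⟨b⟩ => ⟨a.trans b⟩⟩

theorem HolVB.mem_base (V : HolVB X E) (k : X) : k ∈ V.base k :=
  FiberBundle.mem_baseSet_trivializationAt' k

theorem HolVB.isOpen_base (V : HolVB X E) (k : X) : IsOpen (V.base k) := (V.triv k).open_baseSet

theorem HolVB.coord_localSec (V : HolVB X E) {k p : X} (h : p ∈ V.base k) (v : E) :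
    V.coord k p (V.localSec k p v) = v := by
  change p ∈ (V.triv k).baseSet at h
  unfold HolVB.coord HolVB.localSec
  rw [Trivialization.linearMapAt_apply, if_pos h]
  rw [Trivialization.apply_mk_symm _ h]

theorem HolVB.localSec_coord (V : HolVB X E) {k p : X} (h : p ∈ V.base k) (v : V.Fiber p) :
    V.localSec k p (V.coord k p v) = v := by
  change p ∈ (V.triv k).baseSet at h
  unfold HolVB.coord HolVB.localSec
  rw [Trivialization.linearMapAt_apply, if_pos h]
  exact Trivialization.symm_apply_apply_mk _ h v

theorem HolVB.coord_eq (V : HolVB X E) {k p : X} (h : p ∈ V.base k) (v : V.Fiber p) :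
    V.coord k p v = (V.triv k ⟨p, v⟩).2 := by
  change p ∈ (V.triv k).baseSet at h
  unfold HolVB.coord
  rw [Trivialization.linearMapAt_apply, if_pos h]

end Bundles

section Line

variable {X : Type*} [TopologicalSpace X] [ChartedSpace ℂ X]

/-- Holomorphic line bundles. -/
abbrev LineBundle (X : Type*) [TopologicalSpace X] [ChartedSpace ℂ X] := HolVB X ℂ

/-- The local frame of the line bundle `L` around `k`. -/
def HolVB.frame (L : LineBundle X) (k p : X) : L.Fiber p := L.localSec k p 1

/-- `L.trans j k` is the transition function with `frame k = trans j k • frame j`. -/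
def HolVB.trans (L : LineBundle X) (j k p : X) : ℂ := L.coord j p (L.frame k p)

theorem HolVB.coord_frame (L : LineBundle X) {k p : X} (h : p ∈ L.base k) :
    L.coord k p (L.frame k p) = 1 := L.coord_localSec h 1

theorem HolVB.localSec_eq_smul (L : LineBundle X) {k p : X} (h : p ∈ L.base k) (c : ℂ) :
    L.localSec k p c = c • L.frame k p := by
  rw [← L.localSec_coord h (c • L.frame k p), map_smul, L.coord_frame h, smul_eq_mul, mul_one]

theorem HolVB.coord_smul_frame (L : LineBundle X) {k p : X} (h : p ∈ L.base k) (v : L.Fiber p) :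
    L.coord k p v • L.frame k p = v := by
  rw [← L.localSec_eq_smul h, L.localSec_coord h]

theorem HolVB.trans_smul_frame (L : LineBundle X) {j p : X} (h : p ∈ L.base j) (k : X) :
    L.trans j k p • L.frame j p = L.frame k p := L.coord_smul_frame h _

theorem HolVB.trans_self (L : LineBundle X) {k p : X} (h : p ∈ L.base k) :
    L.trans k k p = 1 := L.coord_frame h

theorem HolVB.trans_mul (L : LineBundle X) {i j k p : X} (hj : p ∈ L.base j) :
    L.trans i j p * L.trans j k p = L.trans i k p := by
  unfold HolVB.trans
  conv_rhs => rw [← L.trans_smul_frame hj k, map_smul, smul_eq_mul]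
  rw [mul_comm]; rfl

theorem HolVB.trans_ne_zero (L : LineBundle X) {j k p : X} (hj : p ∈ L.base j)
    (hk : p ∈ L.base k) : L.trans j k p ≠ 0 := by
  intro h0
  have := L.trans_mul (i := k) (j := j) (k := k) hj
  rw [h0, L.trans_self hk] at this
  simp at this

theorem HolVB.contMDiffOn_trans (L : LineBundle X) (j k : X) :
    ContMDiffOn 𝓘(ℂ) 𝓘(ℂ) ω (L.trans j k) (L.base j ∩ L.base k) := by
  have h := contMDiffOn_coordChangeL (n := ω) (IB := 𝓘(ℂ)) (L.triv k) (L.triv j)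
  have h2 := h.clm_apply (contMDiffOn_const (c := (1 : ℂ)))
  rw [inter_comm] at h2
  refine h2.congr fun p hp => ?_
  unfold HolVB.trans HolVB.frame HolVB.localSec
  rw [L.coord_eq hp.1]
  exact ((L.triv k).coordChangeL_apply (L.triv j) ⟨hp.2, hp.1⟩ 1).symm

end Line

section Surface

variable (X : Type*) [TopologicalSpace X] [ChartedSpace ℂ X] [IsManifold 𝓘(ℂ) ω X]

/-- The holomorphic tangent bundle `K⁻¹` of `X`. -/
def tangentLine : LineBundle X where
  Fiber := fun x => TangentSpace 𝓘(ℂ) x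

/-- The fibre of `K⁻¹` at `x`. -/
abbrev T {X : Type*} [TopologicalSpace X] [ChartedSpace ℂ X] [IsManifold 𝓘(ℂ) ω X] (x : X) : Type :=
  (tangentLine X).Fiber x

/-- The space `H⁰(X, K)` of holomorphic one-forms. -/
def holomorphicForms : Submodule ℂ (∀ x : X, T x →ₗ[ℂ] ℂ) where
  carrier := {θ | ∀ k, ContMDiffOn 𝓘(ℂ) 𝓘(ℂ) ω
    (fun p => θ p ((tangentLine X).frame k p)) ((tangentLine X).base k)}
  add_mem' ha hb k := (ha k).add (hb k)
  zero_mem' _ := contMDiffOn_const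
  smul_mem' c _ ha k := (contMDiffOn_const (c := c)).mul (ha k)

/-- The genus of `X`, as the dimension of the space of holomorphic one-forms. -/
def genus : ℕ := Module.finrank ℂ (holomorphicForms X)

/-- A holomorphic quadratic differential, i.e. a holomorphic section of `K²`. -/
structure QuadraticDifferential where
  toFun : ∀ x : X, T x →ₗ[ℂ] T x →ₗ[ℂ] ℂ
  hol : ∀ k, ContMDiffOn 𝓘(ℂ) 𝓘(ℂ) ω
    (fun p => toFun p ((tangentLine X).frame k p) ((tangentLine X).frame k p))
    ((tangentLine X).base k)

end Surface

section Degree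

variable {X : Type*} [TopologicalSpace X] [ChartedSpace ℂ X]

/-- The germ at `k` of a (possibly discontinuous) section, read in the chart and in the
trivialisation around `k`. -/
def HolVB.localExpr (L : LineBundle X) (s : ∀ x, L.Fiber x) (k : X) (z : ℂ) : ℂ :=
  L.coord k ((chartAt ℂ k).symm z) (s ((chartAt ℂ k).symm z))

/-- `L` has degree `d`: it has a meromorphic section, vanishing identically near no point,
whose divisor has degree `d`. -/
def HolVB.HasDegree (L : LineBundle X) (d : ℤ) : Prop :=
  ∃ s : ∀ x, L.Fiber x,
    (∀ k, MeromorphicAt (L.localExpr s k) (chartAt ℂ k k) ∧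
      meromorphicOrderAt (L.localExpr s k) (chartAt ℂ k k) ≠ ⊤) ∧
    ∑ᶠ k, (meromorphicOrderAt (L.localExpr s k) (chartAt ℂ k k)).untop₀ = d

variable (X) in
/-- `Pic^d X`: isomorphism classes of holomorphic line bundles of degree `d`. -/
def PicD (d : ℤ) : Type _ :=
  {p : Quotient (HolVB.setoid (X := X) (E := ℂ)) // ∃ L : LineBundle X, ⟦L⟧ = p ∧ L.HasDegree d}

end Degree

section Higgs

variable (X : Type*) [TopologicalSpace X] [ChartedSpace ℂ X] [IsManifold 𝓘(ℂ) ω X]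

/-- Holomorphic vector bundles of rank two. -/
abbrev RankTwo (X : Type*) [TopologicalSpace X] [ChartedSpace ℂ X] := HolVB X (Fin 2 → ℂ)

/-- The fibre `Λ²F_x^*`, as the space of alternating bilinear forms on `F_x`. -/
abbrev DetDual {X : Type*} [TopologicalSpace X] [ChartedSpace ℂ X] (F : RankTwo X) (x : X) : Type :=
  F.Fiber x [⋀^Fin 2]→ₗ[ℂ] ℂ

/-- The standard alternating form on `ℂ²`. -/
def stdForm : (Fin 2 → ℂ) [⋀^Fin 2]→ₗ[ℂ] ℂ := Matrix.detRowAlternating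

/-- The local frame of `Λ²F^*` dual to the frame of `Λ²F` given by the trivialisation of `F`
around `k`. -/
def HolVB.detForm {X : Type*} [TopologicalSpace X] [ChartedSpace ℂ X] (F : RankTwo X) (k p : X) :
    DetDual F p := stdForm.compLinearMap (F.coord k p)

/-- The local frame of `F` given by the trivialisation around `k`. -/
def HolVB.basisSec {X : Type*} [TopologicalSpace X] [ChartedSpace ℂ X] (F : RankTwo X) (k p : X)
    (i : Fin 2) : F.Fiber p := F.localSec k p (Pi.single i 1)

/-- An SU(1,2) Higgs bundle `(F, β, γ)`: a rank two bundle `F` with holomorphic maps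
`β : K⁻¹ ⊗ Λ²F^* → F` and `γ : F → Λ²F^* ⊗ K`, the latter written as `K⁻¹ ⊗ F → Λ²F^*`.
Holomorphy means that the coefficients in local holomorphic frames are holomorphic. -/
structure SU12Higgs where
  F : RankTwo X
  β : ∀ x, T x →ₗ[ℂ] DetDual F x →ₗ[ℂ] F.Fiber x
  γ : ∀ x, T x →ₗ[ℂ] F.Fiber x →ₗ[ℂ] DetDual F x
  β_hol : ∀ k, ContMDiffOn 𝓘(ℂ) 𝓘(ℂ, Fin 2 → ℂ) ω
    (fun p => F.coord k p (β p ((tangentLine X).frame k p) (F.detForm k p)))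
    (F.base k ∩ (tangentLine X).base k)
  γ_hol : ∀ k i, ContMDiffOn 𝓘(ℂ) 𝓘(ℂ) ω
    (fun p => γ p ((tangentLine X).frame k p) (F.basisSec k p i) (F.basisSec k p))
    (F.base k ∩ (tangentLine X).base k)

variable {X} in
/-- An isomorphism of SU(1,2) Higgs bundles: an isomorphism `α : F → F'` which, together with the
isomorphism `(Λ²α)^{-t} : Λ²F^* → Λ²F'^*` that it induces, intertwines `β, β'` and `γ, γ'`. -/
structure SU12Higgs.Iso (A B : SU12Higgs X) where
  α : A.F.Iso B.F
  comm_β : ∀ x (v : T x) (w : DetDual A.F x),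
    B.β x v (w.compLinearMap (α.toEquiv x).symm.toLinearMap) = α.toEquiv x (A.β x v w)
  comm_γ : ∀ x (v : T x) (f : A.F.Fiber x),
    B.γ x v (α.toEquiv x f) = (A.γ x v f).compLinearMap (α.toEquiv x).symm.toLinearMap

end Higgs

section Zeros

variable {X : Type*} [TopologicalSpace X] [ChartedSpace ℂ X] [IsManifold 𝓘(ℂ) ω X]

namespace QuadraticDifferential

/-- The zero set `D` of `q`. -/
def zeros (q : QuadraticDifferential X) : Set X := {x | q.toFun x = 0}

/-- The coefficient of `q` in the frame of `K²` around `k`. -/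
def coeff (q : QuadraticDifferential X) (k p : X) : ℂ :=
  q.toFun p ((tangentLine X).frame k p) ((tangentLine X).frame k p)

/-- All zeros of `q` are simple. -/
def HasSimpleZeros (q : QuadraticDifferential X) : Prop :=
  ∀ x ∈ q.zeros, deriv (fun z => q.coeff x ((chartAt ℂ x).symm z)) (chartAt ℂ x x) ≠ 0

variable (q : QuadraticDifferential X)

theorem coeff_eq_zero_iff {k p : X} (h : p ∈ (tangentLine X).base k) :
    q.coeff k p = 0 ↔ p ∈ q.zeros := by
  constructor
  · intro h0
    refine LinearMap.ext fun v => LinearMap.ext fun w => ?_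
    rw [← (tangentLine X).coord_smul_frame h v, ← (tangentLine X).coord_smul_frame h w]
    simp only [map_smul, LinearMap.smul_apply]
    change _ • _ • q.coeff k p = _
    simp [h0]
  · intro h0
    change q.toFun p = 0 at h0
    simp [coeff, h0]

theorem coeff_change {j k p : X} (h : p ∈ (tangentLine X).base j) :
    q.coeff k p = (tangentLine X).trans j k p ^ 2 * q.coeff j p := by
  unfold coeff
  rw [← (tangentLine X).trans_smul_frame h k]
  simp only [map_smul, LinearMap.smul_apply, smul_eq_mul]
  ring

theorem isClosed_zeros_diff (hq : q.HasSimpleZeros) (x : X) : IsClosed (q.zeros \ {x}) := by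
  rw [← isOpen_compl_iff, isOpen_iff_mem_nhds]
  intro p hp
  have hb : ∀ᶠ p' in 𝓝 p, p' ∈ (tangentLine X).base p :=
    ((tangentLine X).isOpen_base p).mem_nhds ((tangentLine X).mem_base p)
  by_cases hz : p ∈ q.zeros
  · have hpx : p = x := by
      by_contra hne
      exact hp ⟨hz, hne⟩
    have h0 : q.coeff p p = 0 := (q.coeff_eq_zero_iff ((tangentLine X).mem_base p)).2 hz
    have hd := (differentiableAt_of_deriv_ne_zero (hq p hz)).hasDerivAt
    have hne := hd.eventually_ne (hq p hz) (c := 0)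
    rw [eventually_nhdsWithin_iff] at hne
    have h1 := (chartAt ℂ p).continuousAt (mem_chart_source ℂ p) |>.eventually hne
    have h2 : ∀ᶠ p' in 𝓝 p, p' ∈ (chartAt ℂ p).source :=
      (chartAt ℂ p).open_source.mem_nhds (mem_chart_source ℂ p)
    filter_upwards [hb, h1, h2] with p' hb h1 h2 hmem
    have hne' : p' ≠ p := fun h => hmem.2 (h.trans hpx)
    have h3 := h1 (fun h => hne' ((chartAt ℂ p).injOn h2 (mem_chart_source ℂ p) h))
    rw [(chartAt ℂ p).left_inv h2] at h3
    exact h3 ((q.coeff_eq_zero_iff hb).2 hmem.1)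
  · have h0 : q.coeff p p ≠ 0 := fun h =>
      hz ((q.coeff_eq_zero_iff ((tangentLine X).mem_base p)).1 h)
    have hc : ContinuousAt (q.coeff p) p :=
      ((q.hol p).continuousOn).continuousAt
        (((tangentLine X).isOpen_base p).mem_nhds ((tangentLine X).mem_base p))
    filter_upwards [hb, hc.eventually_ne h0] with p' hb h1 hmem
    exact h1 ((q.coeff_eq_zero_iff hb).2 hmem.1)

end QuadraticDifferential

end Zeros

section Hecke

variable {X : Type*} [TopologicalSpace X] [ChartedSpace ℂ X] [IsManifold 𝓘(ℂ) ω X]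

/-- The fibre at `x` of `L⁻²K`, as maps `K⁻¹ → (L ⊗ L)^*`. -/
abbrev FstFiber (L : LineBundle X) (x : X) : Type :=
  T x →ₗ[ℂ] L.Fiber x →ₗ[ℂ] L.Fiber x →ₗ[ℂ] ℂ

/-- The fibre at `x` of `LK`, as maps `K⁻¹ → L`. -/
abbrev SndFiber (L : LineBundle X) (x : X) : Type := T x →ₗ[ℂ] L.Fiber x

/-- The fibre at `x` of `V = L⁻²K ⊕ LK`. -/
abbrev VFiber (L : LineBundle X) (x : X) : Type := FstFiber L x × SndFiber L x

/-- The local frame `dz` of `K` around `k`. -/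
def dz (k p : X) : T p →ₗ[ℂ] ℂ := (tangentLine X).coord k p

/-- The local frame of `L⁻²K` around `k`. -/
def fstFrame (L : LineBundle X) (k p : X) : FstFiber L p :=
  (dz k p).smulRight ((L.coord k p).smulRight (L.coord k p))

/-- The local frame of `LK` around `k`. -/
def sndFrame (L : LineBundle X) (k p : X) : SndFiber L p := (dz k p).smulRight (L.frame k p)

/-- The projective line `ℙ(V_x^*)` of lines in `V_x^*`. -/
abbrev PFiber (L : LineBundle X) (x : X) : Type := ℙ ℂ (Module.Dual ℂ (VFiber L x))

/-- The point `[0:1]`: the line of functionals vanishing on the summand `L⁻²K`. -/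
def IsZeroOne {L : LineBundle X} {x : X} (l : PFiber L x) : Prop :=
  ∀ ξ ∈ l.submodule, ∀ w : FstFiber L x, ξ (w, 0) = 0

/-- The point `[1:0]`: the line of functionals vanishing on the summand `LK`. -/
def IsOneZero {L : LineBundle X} {x : X} (l : PFiber L x) : Prop :=
  ∀ ξ ∈ l.submodule, ∀ w : SndFiber L x, ξ (0, w) = 0

/-- A choice of a line `ℓ_x ⊂ V_x^*` at each zero `x` of `q`. -/
abbrev Lines (q : QuadraticDifferential X) (L : LineBundle X) : Type _ :=
  ∀ x : q.zeros, PFiber L x.1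

variable {q : QuadraticDifferential X} {L : LineBundle X}

open scoped Classical in
/-- Coordinates of a vector spanning `ℓ_k`, in the frame around `k`; for `k` not a zero of `q` we
put `(0, 1)`. -/
def lineCoord (y : Lines q L) (k : X) : ℂ × ℂ :=
  if h : k ∈ q.zeros then
    ((y ⟨k, h⟩).rep (fstFrame L k k, 0), (y ⟨k, h⟩).rep (0, sndFrame L k k))
  else (0, 1)

open scoped Classical in
/-- A frame of the kernel sheaf of `V → ⨁ₓ V_x / ker ℓ_x` (the sections of `V` whose value at each
zero `x` of `q` is killed by `ℓ_x`) on the neighbourhood `patch q L k` of `k`, written as the columns of a matrix in the frame of `V` around `k`. With `(a, b)` the coordinates of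
the line at `k`, the frame is `(1, -a/b), (0, q)` if `b ≠ 0`, and `(q, 0), (0, 1)` if `b = 0`;
here `q` stands for its coefficient, which is a uniformiser at `k` if `k` is a zero of `q`. -/
def heckeFrame (y : Lines q L) (k p : X) : Matrix (Fin 2) (Fin 2) ℂ :=
  if (lineCoord y k).2 = 0 then !![q.coeff k p, 0; 0, 1]
  else !![1, 0; -((lineCoord y k).1 / (lineCoord y k).2), q.coeff k p]

variable (q L) in
/-- A neighbourhood of `k` over which `L` and `K` are framed and which contains no zero of `q`,
except possibly `k`. -/
def patch (k : X) : Set X := (L.base k ∩ (tangentLine X).base k) \ (q.zeros \ {k})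

/-- The transition matrix of `V` from the frame around `k` to the frame around `j`. -/
def vTrans (L : LineBundle X) (j k p : X) : Matrix (Fin 2) (Fin 2) ℂ :=
  !![((tangentLine X).trans j k p)⁻¹ * (L.trans j k p ^ 2)⁻¹, 0;
    0, ((tangentLine X).trans j k p)⁻¹ * L.trans j k p]

open scoped Classical in
/-- The transition matrix of the kernel bundle from the frame around `k` to that around `j`. -/
def heckeTrans (y : Lines q L) (j k p : X) : Matrix (Fin 2) (Fin 2) ℂ :=
  if j = k then 1 else (heckeFrame y j p)⁻¹ * vTrans L j k p * heckeFrame y k p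

theorem det_heckeFrame (y : Lines q L) (k p : X) : (heckeFrame y k p).det = q.coeff k p := by
  unfold heckeFrame
  split_ifs <;> simp [Matrix.det_fin_two]

theorem coeff_ne_zero {k p : X} (hp : p ∈ patch q L k) (h : p ≠ k) : q.coeff k p ≠ 0 := fun h0 =>
  hp.2 ⟨(q.coeff_eq_zero_iff hp.1.2).1 h0, h⟩

theorem coeff_ne_zero' {j k p : X} (hj : p ∈ patch q L j) (hk : p ∈ patch q L k) (h : j ≠ k) :
    q.coeff j p ≠ 0 := by
  intro h0
  have hz := (q.coeff_eq_zero_iff hj.1.2).1 h0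
  have h1 : p = j := by
    by_contra hne
    exact hj.2 ⟨hz, hne⟩
  have h2 : p = k := by
    by_contra hne
    exact hk.2 ⟨hz, hne⟩
  exact h (h1.symm.trans h2)

theorem mem_patch (k : X) : k ∈ patch q L k :=
  ⟨⟨L.mem_base k, (tangentLine X).mem_base k⟩, fun h => h.2 rfl⟩

theorem isOpen_patch (hq : q.HasSimpleZeros) (k : X) : IsOpen (patch q L k) :=
  ((L.isOpen_base k).inter ((tangentLine X).isOpen_base k)).sdiff (q.isClosed_zeros_diff hq k)

theorem vTrans_self {k p : X} (hk : p ∈ patch q L k) : vTrans L k k p = 1 := by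
  unfold vTrans
  rw [L.trans_self hk.1.1, (tangentLine X).trans_self hk.1.2]
  ext i j
  fin_cases i <;> fin_cases j <;> simp

theorem vTrans_mul {i j k p : X} (hj : p ∈ patch q L j) :
    vTrans L i j p * vTrans L j k p = vTrans L i k p := by
  unfold vTrans
  rw [← L.trans_mul (i := i) (j := j) (k := k) hj.1.1,
    ← (tangentLine X).trans_mul (i := i) (j := j) (k := k) hj.1.2]
  ext i j
  fin_cases i <;> fin_cases j <;> simp [Matrix.mul_apply, Fin.sum_univ_two, mul_pow] <;> ring

theorem heckeFrame_mul_trans (y : Lines q L) {j k p : X} (hj : p ∈ patch q L j)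
    (hk : p ∈ patch q L k) :
    heckeFrame y j p * heckeTrans y j k p = vTrans L j k p * heckeFrame y k p := by
  unfold heckeTrans
  split_ifs with h
  · subst h
    rw [vTrans_self hj, one_mul, mul_one]
  · have hu : IsUnit (heckeFrame y j p).det := by
      rw [det_heckeFrame]
      exact (coeff_ne_zero' hj hk h).isUnit
    rw [mul_assoc, Matrix.mul_nonsing_inv_cancel_left _ _ hu]

theorem heckeTrans_comp (y : Lines q L) {i j k p : X} (hi : p ∈ patch q L i)
    (hj : p ∈ patch q L j) (hk : p ∈ patch q L k) :
    heckeTrans y i j p * heckeTrans y j k p = heckeTrans y i k p := by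
  by_cases hik : i = k
  · subst hik
    by_cases hij : i = j
    · subst hij
      simp [heckeTrans]
    · have hu : IsUnit (heckeFrame y i p).det := by
        rw [det_heckeFrame]
        exact (coeff_ne_zero' hi hj hij).isUnit
      have h1 : heckeFrame y i p * (heckeTrans y i j p * heckeTrans y j i p)
          = heckeFrame y i p * 1 := by
        rw [← mul_assoc, heckeFrame_mul_trans y hi hj, mul_assoc, heckeFrame_mul_trans y hj hi,
          ← mul_assoc, vTrans_mul hj, vTrans_self hi, one_mul, mul_one]
      have h2 := congrArg (fun A => (heckeFrame y i p)⁻¹ * A) h1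
      simp only [Matrix.nonsing_inv_mul_cancel_left _ _ hu] at h2
      rw [h2]
      simp [heckeTrans]
  · have hu : IsUnit (heckeFrame y i p).det := by
      rw [det_heckeFrame]
      exact (coeff_ne_zero' hi hk hik).isUnit
    have h1 : heckeFrame y i p * (heckeTrans y i j p * heckeTrans y j k p)
        = heckeFrame y i p * heckeTrans y i k p := by
      rw [← mul_assoc, heckeFrame_mul_trans y hi hj, mul_assoc, heckeFrame_mul_trans y hj hk,
        ← mul_assoc, vTrans_mul hj, heckeFrame_mul_trans y hi hk]
    have h2 := congrArg (fun A => (heckeFrame y i p)⁻¹ * A) h1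
    simpa only [Matrix.nonsing_inv_mul_cancel_left _ _ hu] using h2

theorem det_heckeTrans (y : Lines q L) {j k p : X} (hj : p ∈ patch q L j)
    (hk : p ∈ patch q L k) : (heckeTrans y j k p).det = (L.trans j k p)⁻¹ := by
  by_cases h : j = k
  · subst h
    simp [heckeTrans, L.trans_self hj.1.1]
  · have h1 := congrArg Matrix.det (heckeFrame_mul_trans y hj hk)
    rw [Matrix.det_mul, Matrix.det_mul, det_heckeFrame, det_heckeFrame,
      q.coeff_change (j := j) (k := k) hj.1.2] at h1
    have h2 := coeff_ne_zero' hj hk h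
    have h3 := (tangentLine X).trans_ne_zero hj.1.2 hk.1.2
    have h4 := L.trans_ne_zero hj.1.1 hk.1.1
    rw [vTrans, Matrix.det_fin_two_of] at h1
    apply mul_left_cancel₀ h2
    rw [h1]
    field_simp
    ring

theorem contMDiffOn_coeff (k : X) :
    ContMDiffOn 𝓘(ℂ) 𝓘(ℂ) ω (q.coeff k) (patch q L k) :=
  (q.hol k).mono fun _ h => h.1.2

theorem contMDiffOn_heckeFrame (y : Lines q L) (k : X) (a b : Fin 2) :
    ContMDiffOn 𝓘(ℂ) 𝓘(ℂ) ω (fun p => heckeFrame y k p a b) (patch q L k) := by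
  unfold heckeFrame
  split_ifs <;> fin_cases a <;> fin_cases b <;>
    first
    | exact contMDiffOn_const
    | exact contMDiffOn_coeff k

theorem contMDiffOn_vTrans (j k : X) (a b : Fin 2) :
    ContMDiffOn 𝓘(ℂ) 𝓘(ℂ) ω (fun p => vTrans L j k p a b) (patch q L j ∩ patch q L k) := by
  have hL : ContMDiffOn 𝓘(ℂ) 𝓘(ℂ) ω (L.trans j k) (patch q L j ∩ patch q L k) :=
    (L.contMDiffOn_trans j k).mono fun p h => ⟨h.1.1.1, h.2.1.1⟩
  have hT : ContMDiffOn 𝓘(ℂ) 𝓘(ℂ) ω ((tangentLine X).trans j k) (patch q L j ∩ patch q L k) :=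
    ((tangentLine X).contMDiffOn_trans j k).mono fun p h => ⟨h.1.1.2, h.2.1.2⟩
  have hL0 : ∀ p ∈ patch q L j ∩ patch q L k, L.trans j k p ≠ 0 :=
    fun p h => L.trans_ne_zero h.1.1.1 h.2.1.1
  have hT0 : ∀ p ∈ patch q L j ∩ patch q L k, (tangentLine X).trans j k p ≠ 0 :=
    fun p h => (tangentLine X).trans_ne_zero h.1.1.2 h.2.1.2
  have hTi := hT.inv₀ hT0
  unfold vTrans
  fin_cases a <;> fin_cases b
  · exact hTi.mul ((hL.pow 2).inv₀ fun p hp => pow_ne_zero 2 (hL0 p hp))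
  · exact contMDiffOn_const
  · exact contMDiffOn_const
  · exact hTi.mul hL

theorem contMDiffOn_matrix_mul {s : Set X} {A B : X → Matrix (Fin 2) (Fin 2) ℂ}
    (hA : ∀ a b, ContMDiffOn 𝓘(ℂ) 𝓘(ℂ) ω (fun p => A p a b) s)
    (hB : ∀ a b, ContMDiffOn 𝓘(ℂ) 𝓘(ℂ) ω (fun p => B p a b) s) (a b : Fin 2) :
    ContMDiffOn 𝓘(ℂ) 𝓘(ℂ) ω (fun p => (A p * B p) a b) s := by
  simp only [Matrix.mul_apply, Fin.sum_univ_two]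
  exact ((hA a 0).mul (hB 0 b)).add ((hA a 1).mul (hB 1 b))

theorem contMDiffOn_heckeTrans (y : Lines q L) (j k : X) (a b : Fin 2) :
    ContMDiffOn 𝓘(ℂ) 𝓘(ℂ) ω (fun p => heckeTrans y j k p a b)
      (patch q L j ∩ patch q L k) := by
  unfold heckeTrans
  split_ifs with h
  · exact contMDiffOn_const
  · refine contMDiffOn_matrix_mul (contMDiffOn_matrix_mul ?_ (contMDiffOn_vTrans j k))
      (fun a b => (contMDiffOn_heckeFrame y k a b).mono inter_subset_right) a b
    intro a b
    have hF := fun a b => (contMDiffOn_heckeFrame y j a b).mono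
      (inter_subset_left (s := patch q L j) (t := patch q L k))
    have hi : ContMDiffOn 𝓘(ℂ) 𝓘(ℂ) ω (fun p => (q.coeff j p)⁻¹)
        (patch q L j ∩ patch q L k) :=
      ((contMDiffOn_coeff j).mono inter_subset_left).inv₀
        fun p hp => coeff_ne_zero' hp.1 hp.2 h
    simp only [Matrix.inv_def, det_heckeFrame, Ring.inverse_eq_inv', Matrix.adjugate_fin_two,
      Matrix.smul_apply, smul_eq_mul]
    fin_cases a <;> fin_cases b
    · exact hi.mul (hF 1 1)
    · exact hi.mul (hF 0 1).neg
    · exact hi.mul (hF 1 0).neg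
    · exact hi.mul (hF 0 0)

/-- The matrix units, as continuous linear maps. -/
def unitCLM (a b : Fin 2) : (Fin 2 → ℂ) →L[ℂ] (Fin 2 → ℂ) :=
  LinearMap.toContinuousLinearMap (Matrix.toLin' (Matrix.single a b 1))

/-- A matrix as a continuous linear map. -/
def matCLM (A : Matrix (Fin 2) (Fin 2) ℂ) : (Fin 2 → ℂ) →L[ℂ] (Fin 2 → ℂ) :=
  LinearMap.toContinuousLinearMap (Matrix.toLin' A)

theorem matCLM_apply (A : Matrix (Fin 2) (Fin 2) ℂ) (v : Fin 2 → ℂ) :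
    matCLM A v = A.mulVec v := rfl

theorem matCLM_eq (A : Matrix (Fin 2) (Fin 2) ℂ) : matCLM A =
    A 0 0 • unitCLM 0 0 + A 0 1 • unitCLM 0 1 + (A 1 0 • unitCLM 1 0 + A 1 1 • unitCLM 1 1) := by
  ext v i
  simp only [matCLM, unitCLM, _root_.add_apply, _root_.smul_apply,
    LinearMap.coe_toContinuousLinearMap', Matrix.toLin'_apply, Pi.add_apply, Pi.smul_apply]
  fin_cases i <;> simp [Matrix.mulVec, dotProduct, Fin.sum_univ_two, Matrix.single_apply]

theorem contMDiffOn_matCLM {s : Set X} {A : X → Matrix (Fin 2) (Fin 2) ℂ}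
    (hA : ∀ a b, ContMDiffOn 𝓘(ℂ) 𝓘(ℂ) ω (fun p => A p a b) s) :
    ContMDiffOn 𝓘(ℂ) 𝓘(ℂ, (Fin 2 → ℂ) →L[ℂ] (Fin 2 → ℂ)) ω (fun p => matCLM (A p)) s := by
  simp only [matCLM_eq]
  have h := fun a b => (hA a b).smul
    (contMDiffOn_const (c := unitCLM a b) (I' := 𝓘(ℂ, (Fin 2 → ℂ) →L[ℂ] (Fin 2 → ℂ))))
  exact ((h 0 0).add (h 0 1)).add ((h 1 0).add (h 1 1))

/-- The cocycle of the kernel bundle. -/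
def heckeCore (hq : q.HasSimpleZeros) (y : Lines q L) :
    VectorBundleCore ℂ X (Fin 2 → ℂ) X where
  baseSet := patch q L
  isOpen_baseSet := isOpen_patch hq
  indexAt := id
  mem_baseSet_at := mem_patch
  coordChange k j p := matCLM (heckeTrans y j k p)
  coordChange_self k p _ v := by simp [matCLM_apply, heckeTrans]
  continuousOn_coordChange k j := by
    rw [inter_comm]
    exact (contMDiffOn_matCLM (contMDiffOn_heckeTrans y j k)).continuousOn
  coordChange_comp i j k p hp v := by
    rw [matCLM_apply, matCLM_apply, matCLM_apply, Matrix.mulVec_mulVec,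
      heckeTrans_comp y hp.2 hp.1.2 hp.1.1]

instance (hq : q.HasSimpleZeros) (y : Lines q L) : (heckeCore hq y).IsContMDiff 𝓘(ℂ) ω where
  contMDiffOn_coordChange k j := by
    change ContMDiffOn _ _ _ _ (patch q L k ∩ patch q L j)
    rw [inter_comm]
    exact contMDiffOn_matCLM (contMDiffOn_heckeTrans y j k)

/-- The rank two bundle `F = ker(V → ⨁ₓ V_x / ker ℓ_x)`, where `V_x / ker ℓ_x` is a skyscraper
sheaf at the zero `x` of `q`. -/
def heckeBundle (hq : q.HasSimpleZeros) (y : Lines q L) : RankTwo X where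
  Fiber := (heckeCore hq y).Fiber

theorem heckeBundle_coord (hq : q.HasSimpleZeros) (y : Lines q L) {k p : X}
    (hp : p ∈ patch q L k) (f : (heckeBundle hq y).Fiber p) :
    (heckeBundle hq y).coord k p f =
      (heckeTrans y k p p).mulVec ((heckeBundle hq y).coord p p f) := by
  have h1 : (heckeBundle hq y).coord k p f = (heckeTrans y k p p).mulVec f :=
    (heckeBundle hq y).coord_eq hp f
  have h2 : (heckeBundle hq y).coord p p f = (heckeTrans y p p p).mulVec f :=
    (heckeBundle hq y).coord_eq (mem_patch p) f
  have h3 : heckeTrans y p p p = 1 := by simp [heckeTrans]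
  rw [h3] at h2
  exact h1.trans (congrArg (heckeTrans y k p p).mulVec (h2.trans (Matrix.one_mulVec _)).symm)

theorem heckeBundle_coord_localSec (hq : q.HasSimpleZeros) (y : Lines q L) {k p : X}
    (hp : p ∈ patch q L k) (v : Fin 2 → ℂ) :
    (heckeBundle hq y).coord p p ((heckeBundle hq y).localSec k p v) =
      (heckeTrans y p k p).mulVec v := by
  have h1 := heckeBundle_coord hq y hp ((heckeBundle hq y).localSec k p v)
  rw [(heckeBundle hq y).coord_localSec hp] at h1
  conv_rhs => rw [h1]
  rw [Matrix.mulVec_mulVec, heckeTrans_comp y (mem_patch p) hp (mem_patch p)]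
  simp [heckeTrans]

/-- The linear map `ℂ² → V_p` given by the frame of `V` around `k`. -/
def vFrameMap (L : LineBundle X) (k p : X) : (Fin 2 → ℂ) →ₗ[ℂ] VFiber L p :=
  (LinearMap.proj 0).smulRight (fstFrame L k p, 0) +
    (LinearMap.proj 1).smulRight (0, sndFrame L k p)

/-- The inclusion `ε = ε₁ ⊕ ε₂ : F → V = L⁻²K ⊕ LK` of the kernel bundle, on fibres. -/
def eps (hq : q.HasSimpleZeros) (y : Lines q L) (x : X) :
    (heckeBundle hq y).Fiber x →ₗ[ℂ] VFiber L x :=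
  vFrameMap L x x ∘ₗ Matrix.toLin' (heckeFrame y x x) ∘ₗ (heckeBundle hq y).coord x x

theorem eps_fst (hq : q.HasSimpleZeros) (y : Lines q L) (x : X)
    (f : (heckeBundle hq y).Fiber x) : (eps hq y x f).1 =
      (heckeFrame y x x).mulVec ((heckeBundle hq y).coord x x f) 0 • fstFrame L x x := by
  simp [eps, vFrameMap, Matrix.toLin'_apply]

theorem eps_snd (hq : q.HasSimpleZeros) (y : Lines q L) (x : X)
    (f : (heckeBundle hq y).Fiber x) : (eps hq y x f).2 =
      (heckeFrame y x x).mulVec ((heckeBundle hq y).coord x x f) 1 • sndFrame L x x := by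
  simp [eps, vFrameMap, Matrix.toLin'_apply]

/-- The canonical isomorphism `W^* ⊗ Λ²W → W`, `h ⊗ s₁ ∧ s₂ ↦ h(s₂)s₁ - h(s₁)s₂`, for `W` of
dimension two. -/
def phi {W : Type*} [AddCommGroup W] [Module ℂ W] (h : Module.Dual ℂ W) (s₁ s₂ : W) : W :=
  h s₂ • s₁ - h s₁ • s₂

/-- The isomorphism `L → Λ²F^*` on fibres, sending the frame of `L` around `x` to the frame of
`Λ²F^*` around `x`. It is the transpose of the isomorphism `a : L⁻¹ → Λ²F` with
`Λ²ε ∘ a = q : L⁻¹ → L⁻¹K²`. -/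
def ofL (hq : q.HasSimpleZeros) (y : Lines q L) (x : X) :
    L.Fiber x →ₗ[ℂ] DetDual (heckeBundle hq y) x :=
  (L.coord x x).smulRight ((heckeBundle hq y).detForm x x)

/-- `γ = ε₂ : F → LK ≅ Λ²F^* ⊗ K`, on fibres. -/
def heckeγ (hq : q.HasSimpleZeros) (y : Lines q L) (x : X) :
    T x →ₗ[ℂ] (heckeBundle hq y).Fiber x →ₗ[ℂ] DetDual (heckeBundle hq y) x :=
  LinearMap.mk₂ ℂ (fun v f => ofL hq y x ((eps hq y x f).2 v))
    (by intros; simp only [map_add]) (by intros; simp only [map_smul])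
    (by intros; simp only [map_add, Prod.snd_add, LinearMap.add_apply])
    (by intros; simp only [map_smul, Prod.smul_snd, LinearMap.smul_apply])

/-- The functional `ε₁^t(v ⊗ m ⊗ n)` on `F_x`, for `v ∈ K⁻¹_x` and `m, n ∈ L_x`. -/
def epsFstT (hq : q.HasSimpleZeros) (y : Lines q L) (x : X) (v : T x) (m n : L.Fiber x) :
    Module.Dual ℂ ((heckeBundle hq y).Fiber x) where
  toFun f := (eps hq y x f).1 v m n
  map_add' := by intros; simp only [map_add, Prod.fst_add, LinearMap.add_apply]
  map_smul' := by
    intros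
    simp only [map_smul, Prod.smul_fst, LinearMap.smul_apply, RingHom.id_apply]

/-- `β = -φ_F ∘ (ε₁^t ⊗ 1) : L²K⁻¹ ⊗ L⁻¹ → F^* ⊗ Λ²F → F`, on fibres. Here `w ∈ Λ²F_x^* ≅ L_x` is
written as `w(e₀, e₁)` times the frame `λ` of `L`, and `λ` as `λ² ⊗ λ⁻¹`, where `λ⁻¹` corresponds
to `e₀ ∧ e₁ ∈ Λ²F_x` for the frame `e₀, e₁` of `F` around `x`. -/
def heckeβ (hq : q.HasSimpleZeros) (y : Lines q L) (x : X) :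
    T x →ₗ[ℂ] DetDual (heckeBundle hq y) x →ₗ[ℂ] (heckeBundle hq y).Fiber x :=
  LinearMap.mk₂ ℂ
    (fun v w => w ((heckeBundle hq y).basisSec x x) •
      phi (-epsFstT hq y x v (L.frame x x) (L.frame x x))
        ((heckeBundle hq y).basisSec x x 0) ((heckeBundle hq y).basisSec x x 1))
    (by
      intros
      simp only [phi, epsFstT, map_add, LinearMap.neg_apply, LinearMap.coe_mk, AddHom.coe_mk,
        LinearMap.add_apply]
      module)
    (by
      intros
      simp only [phi, epsFstT, map_smul, LinearMap.neg_apply, LinearMap.coe_mk, AddHom.coe_mk,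
        LinearMap.smul_apply, smul_eq_mul]
      module)
    (by intros; rw [AlternatingMap.add_apply, add_smul])
    (by intros; rw [AlternatingMap.smul_apply, smul_assoc])

theorem heckeBundle_basisSec (hq : q.HasSimpleZeros) (y : Lines q L) {k p : X}
    (hp : p ∈ patch q L k) (i a : Fin 2) :
    (heckeBundle hq y).coord p p ((heckeBundle hq y).basisSec k p i) a =
      heckeTrans y p k p a i := by
  change (heckeBundle hq y).coord p p ((heckeBundle hq y).localSec k p _) a = _
  rw [heckeBundle_coord_localSec hq y hp]
  simp

theorem detForm_apply (F : RankTwo X) (k p : X) (s : Fin 2 → F.Fiber p) :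
    F.detForm k p s = F.coord k p (s 0) 0 * F.coord k p (s 1) 1 -
      F.coord k p (s 0) 1 * F.coord k p (s 1) 0 :=
  Matrix.det_fin_two (Matrix.of fun i => F.coord k p (s i))

theorem heckeBundle_detForm (hq : q.HasSimpleZeros) (y : Lines q L) {j k p : X}
    (hj : p ∈ patch q L j) (hk : p ∈ patch q L k) :
    (heckeBundle hq y).detForm j p ((heckeBundle hq y).basisSec k p) = L.trans k j p := by
  have hc : ∀ i a, (heckeBundle hq y).coord j p ((heckeBundle hq y).basisSec k p i) a =
      heckeTrans y j k p a i := by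
    intro i a
    rw [heckeBundle_coord hq y hj]
    have h : (heckeBundle hq y).coord p p ((heckeBundle hq y).basisSec k p i) =
        fun a => heckeTrans y p k p a i := funext (heckeBundle_basisSec hq y hk i)
    rw [h, ← heckeTrans_comp y hj (mem_patch p) hk]
    rfl
  have hl : L.trans k j p * L.trans j k p = 1 := by
    rw [L.trans_mul hj.1.1, L.trans_self hk.1.1]
  rw [detForm_apply, hc, hc, hc, hc, mul_comm (heckeTrans y j k p 1 0), ← Matrix.det_fin_two,
    det_heckeTrans y hj hk]
  exact (eq_inv_of_mul_eq_one_left hl).symm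

theorem heckeγ_coeff (hq : q.HasSimpleZeros) (y : Lines q L) {k p : X} (hp : p ∈ patch q L k)
    (i : Fin 2) :
    heckeγ hq y p ((tangentLine X).frame k p) ((heckeBundle hq y).basisSec k p i)
      ((heckeBundle hq y).basisSec k p) = heckeFrame y k p 1 i := by
  have hpp : p ∈ patch q L p := mem_patch p
  have hmul := congrFun (congrFun (heckeFrame_mul_trans y hpp hp) 1) i
  have hτ := (tangentLine X).trans_ne_zero hpp.1.2 hp.1.2
  have hl' : L.trans p k p * L.trans k p p = 1 := by
    rw [L.trans_mul hp.1.1, L.trans_self hpp.1.1]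
  have h1 : (heckeFrame y p p).mulVec
      ((heckeBundle hq y).coord p p ((heckeBundle hq y).basisSec k p i)) 1 =
      (heckeFrame y p p * heckeTrans y p k p) 1 i := by
    have h : (heckeBundle hq y).coord p p ((heckeBundle hq y).basisSec k p i) =
        fun a => heckeTrans y p k p a i := funext (heckeBundle_basisSec hq y hp i)
    rw [h]
    rfl
  change (L.coord p p ((eps hq y p ((heckeBundle hq y).basisSec k p i)).2
    ((tangentLine X).frame k p))) * (heckeBundle hq y).detForm p p _ = _
  rw [eps_snd, heckeBundle_detForm hq y hpp hp, h1, hmul]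
  have h4 : dz p p ((tangentLine X).frame k p) = (tangentLine X).trans p k p := rfl
  simp only [sndFrame, LinearMap.smul_apply, LinearMap.smulRight_apply, map_smul, h4,
    L.coord_frame hpp.1.1, smul_eq_mul, vTrans, Matrix.mul_apply, Fin.sum_univ_two, Matrix.of_apply,
    Matrix.cons_val', Matrix.cons_val_zero, Matrix.cons_val_one, Matrix.cons_val_fin_one]
  field_simp
  linear_combination (heckeFrame y k p 1 i) * hl'

theorem heckeβ_coeff (hq : q.HasSimpleZeros) (y : Lines q L) {k p : X} (hp : p ∈ patch q L k) :
    (heckeBundle hq y).coord k p (heckeβ hq y p ((tangentLine X).frame k p)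
      ((heckeBundle hq y).detForm k p)) = ![-heckeFrame y k p 0 1, heckeFrame y k p 0 0] := by
  have hpp : p ∈ patch q L p := mem_patch p
  have hdet := det_heckeTrans y hp hpp
  have hτ := (tangentLine X).trans_ne_zero hp.1.2 hpp.1.2
  have hl := L.trans_ne_zero hp.1.1 hpp.1.1
  have hτ' : (tangentLine X).trans p k p * (tangentLine X).trans k p p = 1 := by
    rw [(tangentLine X).trans_mul hp.1.2, (tangentLine X).trans_self hpp.1.2]
  have hl' : L.trans p k p * L.trans k p p = 1 := by
    rw [L.trans_mul hp.1.1, L.trans_self hpp.1.1]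
  have hm := heckeFrame_mul_trans y hp hpp
  have hb : ∀ i a, (heckeBundle hq y).coord p p ((heckeBundle hq y).basisSec p p i) a =
      if a = i then 1 else 0 := by
    intro i a
    rw [heckeBundle_basisSec hq y hpp]
    simp [heckeTrans, Matrix.one_apply]
  have hc : ∀ i a, (heckeBundle hq y).coord k p ((heckeBundle hq y).basisSec p p i) a =
      heckeTrans y k p p a i := by
    intro i a
    rw [heckeBundle_coord hq y hp, Matrix.mulVec, dotProduct, Fin.sum_univ_two, hb, hb]
    fin_cases i <;> simp
  have h4 : dz p p ((tangentLine X).frame k p) = (tangentLine X).trans p k p := rfl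
  have hε : ∀ i, epsFstT hq y p ((tangentLine X).frame k p) (L.frame p p) (L.frame p p)
      ((heckeBundle hq y).basisSec p p i) =
      (tangentLine X).trans p k p * heckeFrame y p p 0 i := by
    intro i
    change (eps hq y p _).1 _ _ _ = _
    rw [eps_fst]
    simp only [fstFrame, LinearMap.smul_apply, LinearMap.smulRight_apply, h4,
      L.coord_frame hpp.1.1, smul_eq_mul, mul_one]
    rw [mul_comm]
    congr 1
    rw [Matrix.mulVec, dotProduct, Fin.sum_univ_two, hb, hb]
    fin_cases i <;> simp
  have hw := heckeBundle_detForm hq y hp hpp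
  have e0 := congrFun (congrFun hm 0) 0
  have e1 := congrFun (congrFun hm 0) 1
  rw [Matrix.det_fin_two] at hdet
  simp only [vTrans, Matrix.mul_apply, Fin.sum_univ_two, Matrix.of_apply,
    Matrix.cons_val', Matrix.cons_val_zero, Matrix.cons_val_one, Matrix.cons_val_fin_one] at e0 e1
  have hτi : (tangentLine X).trans p k p = ((tangentLine X).trans k p p)⁻¹ :=
    eq_inv_of_mul_eq_one_left hτ'
  have hli : L.trans p k p = (L.trans k p p)⁻¹ := eq_inv_of_mul_eq_one_left hl'
  change (heckeBundle hq y).coord k p ((heckeBundle hq y).detForm k p _ • phi _ _ _) = _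
  rw [hw, phi]
  simp only [LinearMap.neg_apply, hε]
  rw [← hτi, ← inv_pow, ← hli] at e0 e1
  rw [← hli] at hdet
  have hm0 : L.trans p k p ≠ 0 := L.trans_ne_zero hpp.1.1 hp.1.1
  ext a
  simp only [map_smul, map_sub, Pi.smul_apply, Pi.sub_apply, smul_eq_mul, hc]
  apply mul_left_cancel₀ hm0
  fin_cases a
  · simp only [Fin.zero_eta, Fin.isValue, Matrix.cons_val_zero]
    linear_combination heckeTrans y k p p 0 0 * e1 - heckeTrans y k p p 0 1 * e0 -
      heckeFrame y k p 0 1 * hdet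
  · simp only [Fin.mk_one, Fin.isValue, Matrix.cons_val_one, Matrix.cons_val_fin_one]
    linear_combination heckeTrans y k p p 1 0 * e1 - heckeTrans y k p p 1 1 * e0 +
      heckeFrame y k p 0 0 * hdet

/-- The SU(1,2) Higgs bundle `(F_y, β_y, γ_y)` attached to a line bundle `L` and to lines
`y_x ⊂ V_x^*`, `x ∈ D`, where `V = L⁻²K ⊕ LK`. -/
def heckeHiggs (hq : q.HasSimpleZeros) (y : Lines q L) : SU12Higgs X where
  F := heckeBundle hq y
  β := heckeβ hq y
  γ := heckeγ hq y
  β_hol k := by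
    have h : ContMDiffOn 𝓘(ℂ) 𝓘(ℂ, Fin 2 → ℂ) ω
        (fun p => ![-heckeFrame y k p 0 1, heckeFrame y k p 0 0]) (patch q L k) := by
      rw [contMDiffOn_pi_space]
      intro a
      fin_cases a
      · exact (contMDiffOn_heckeFrame y k 0 1).neg
      · exact contMDiffOn_heckeFrame y k 0 0
    exact (h.congr fun p hp => heckeβ_coeff hq y hp).mono inter_subset_left
  γ_hol k i :=
    ((contMDiffOn_heckeFrame y k 1 i).congr fun p hp => heckeγ_coeff hq y hp i).mono
      inter_subset_left

theorem vFrameMap_bijective (k p : X) (hp : p ∈ patch q L k) :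
    Function.Bijective (vFrameMap L k p) := by
  have hf := L.coord_frame hp.1.1
  have ht := (tangentLine X).coord_frame hp.1.2
  constructor
  · intro u v h
    have h1 := congrArg (fun w : VFiber L p =>
      w.1 ((tangentLine X).frame k p) (L.frame k p) (L.frame k p)) h
    have h2 := congrArg (fun w : VFiber L p => L.coord k p (w.2 ((tangentLine X).frame k p))) h
    simp [vFrameMap, fstFrame, sndFrame, dz, hf, ht] at h1 h2
    ext a
    fin_cases a
    · exact h1
    · exact h2
  · rintro ⟨w1, w2⟩
    refine ⟨![w1 ((tangentLine X).frame k p) (L.frame k p) (L.frame k p),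
      L.coord k p (w2 ((tangentLine X).frame k p))], ?_⟩
    refine Prod.ext ?_ ?_
    · refine LinearMap.ext fun v => LinearMap.ext fun m => LinearMap.ext fun n => ?_
      rw [← (tangentLine X).coord_smul_frame hp.1.2 v, ← L.coord_smul_frame hp.1.1 m,
        ← L.coord_smul_frame hp.1.1 n]
      simp [vFrameMap, fstFrame, dz, hf, ht]
    · refine LinearMap.ext fun v => ?_
      rw [← (tangentLine X).coord_smul_frame hp.1.2 v]
      simp [vFrameMap, sndFrame, dz, ht, L.coord_smul_frame hp.1.1]

/-- Away from the zeros of `q`, the inclusion of the kernel bundle is an isomorphism on fibres. -/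
theorem eps_bijective (hq : q.HasSimpleZeros) (y : Lines q L) (x : X) (hx : x ∉ q.zeros) :
    Function.Bijective (eps hq y x) := by
  have h1 : Function.Bijective ((heckeBundle hq y).coord x x) :=
    ⟨fun u v h => by
      rw [← (heckeBundle hq y).localSec_coord (mem_patch x) u, h,
        (heckeBundle hq y).localSec_coord (mem_patch x)],
     fun v => ⟨_, (heckeBundle hq y).coord_localSec (mem_patch x) v⟩⟩
  have hu : IsUnit (heckeFrame y x x).det := by
    rw [det_heckeFrame]
    exact IsUnit.mk0 _ fun h => hx ((q.coeff_eq_zero_iff ((tangentLine X).mem_base x)).1 h)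
  have hu' := (Matrix.isUnit_iff_isUnit_det _).2 hu
  have h2 : Function.Bijective (Matrix.toLin' (heckeFrame y x x)) :=
    ⟨Matrix.mulVec_injective_iff_isUnit.2 hu', Matrix.mulVec_surjective_iff_isUnit.2 hu'⟩
  exact ((vFrameMap_bijective x x (mem_patch (q := q) x)).comp h2).comp h1

/-- At a zero `x` of `q`, the image of `F_x → V_x` is the kernel of the functionals in `y_x`. -/
theorem eps_range (hq : q.HasSimpleZeros) (y : Lines q L) (x : q.zeros) (w : VFiber L x.1) :
    w ∈ LinearMap.range (eps hq y x.1) ↔ ∀ ξ ∈ (y x).submodule, ξ w = 0 := by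
  obtain ⟨k, hk⟩ := x
  obtain ⟨u, rfl⟩ := (vFrameMap_bijective k k (mem_patch (q := q) (L := L) k)).2 w
  have hl : lineCoord y k = ((y ⟨k, hk⟩).rep (fstFrame L k k, 0),
      (y ⟨k, hk⟩).rep (0, sndFrame L k k)) := dif_pos hk
  have hξ : ∀ u : Fin 2 → ℂ, (y ⟨k, hk⟩).rep (vFrameMap L k k u) =
      u 0 * (lineCoord y k).1 + u 1 * (lineCoord y k).2 := by
    intro u
    have : vFrameMap L k k u = u 0 • (fstFrame L k k, 0) + u 1 • (0, sndFrame L k k) := rfl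
    rw [this, map_add, map_smul, map_smul, hl]
    rfl
  have hne : ¬ ((lineCoord y k).1 = 0 ∧ (lineCoord y k).2 = 0) := by
    rintro ⟨h1, h2⟩
    apply (y ⟨k, hk⟩).rep_nonzero
    refine LinearMap.ext fun w => ?_
    obtain ⟨u, rfl⟩ := (vFrameMap_bijective k k (mem_patch (q := q) (L := L) k)).2 w
    rw [hξ, h1, h2]
    simp
  have hc : q.coeff k k = 0 := (q.coeff_eq_zero_iff ((tangentLine X).mem_base k)).2 hk
  have hker : (∀ ξ ∈ (y ⟨k, hk⟩).submodule, ξ (vFrameMap L k k u) = 0) ↔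
      u 0 * (lineCoord y k).1 + u 1 * (lineCoord y k).2 = 0 := by
    rw [← hξ, Projectivization.submodule_eq]
    constructor
    · intro h
      exact h _ (Submodule.mem_span_singleton_self _)
    · intro h ξ hm
      obtain ⟨c, rfl⟩ := Submodule.mem_span_singleton.1 hm
      rw [LinearMap.smul_apply, h, smul_zero]
  rw [hker]
  have hrange : vFrameMap L k k u ∈ LinearMap.range (eps hq y k) ↔
      ∃ v : Fin 2 → ℂ, (heckeFrame y k k).mulVec v = u := by
    constructor
    · rintro ⟨f, hf⟩
      exact ⟨_, (vFrameMap_bijective k k (mem_patch (q := q) (L := L) k)).1 hf⟩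
    · rintro ⟨v, rfl⟩
      refine ⟨(heckeBundle hq y).localSec k k v, ?_⟩
      change vFrameMap L k k ((heckeFrame y k k).mulVec ((heckeBundle hq y).coord k k _)) = _
      rw [(heckeBundle hq y).coord_localSec (mem_patch k)]
  rw [hrange]
  unfold heckeFrame
  split_ifs with hb
  · have ha : (lineCoord y k).1 ≠ 0 := fun h => hne ⟨h, hb⟩
    rw [hb, hc, mul_zero, add_zero, mul_eq_zero, or_iff_left ha]
    constructor
    · rintro ⟨v, rfl⟩
      simp [Matrix.mulVec, dotProduct]
    · intro h
      refine ⟨u, funext fun i => ?_⟩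
      fin_cases i <;> simp [Matrix.mulVec, dotProduct, h]
  · rw [hc]
    constructor
    · rintro ⟨v, rfl⟩
      simp [Matrix.mulVec, dotProduct]
      field_simp
      ring
    · intro h
      refine ⟨u, funext fun i => ?_⟩
      fin_cases i
      · simp [Matrix.mulVec, dotProduct]
      · simp [Matrix.mulVec, dotProduct]
        field_simp
        linear_combination -h

theorem eq_smul_detForm (F : RankTwo X) {k p : X} (hp : p ∈ F.base k) (w : DetDual F p) :
    w = w (F.basisSec k p) • F.detForm k p := by
  have hf : ∀ f : F.Fiber p, f = F.coord k p f 0 • F.basisSec k p 0 +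
      F.coord k p f 1 • F.basisSec k p 1 := by
    intro f
    rw [← F.localSec_coord hp (F.coord k p f 0 • F.basisSec k p 0 +
      F.coord k p f 1 • F.basisSec k p 1), ← F.localSec_coord hp f]
    congr 1
    simp only [HolVB.basisSec, map_add, map_smul, F.coord_localSec hp]
    ext a
    fin_cases a <;> simp
  refine AlternatingMap.ext fun s => ?_
  rw [AlternatingMap.smul_apply, detForm_apply]
  have hs : s = ![s 0, s 1] := by funext i; fin_cases i <;> rfl
  have hb : F.basisSec k p = ![F.basisSec k p 0, F.basisSec k p 1] := by
    funext i; fin_cases i <;> rfl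
  have hadd : ∀ u u' v, w ![u + u', v] = w ![u, v] + w ![u', v] := fun u u' v =>
    w.map_vecCons_add ![v] u u'
  have hsmul : ∀ (c : ℂ) u v, w ![c • u, v] = c * w ![u, v] := fun c u v =>
    w.map_vecCons_smul ![v] c u
  have hswap : ∀ u v, w ![u, v] = -w ![v, u] := by
    intro u v
    rw [← w.map_swap ![v, u] (i := 0) (j := 1) (by decide)]
    congr 1
    funext i
    fin_cases i <;> rfl
  have hzero : ∀ u, w ![u, u] = 0 := fun u =>
    w.map_eq_zero_of_eq ![u, u] (i := 0) (j := 1) rfl (by decide)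
  rw [congrArg w hb]
  conv_lhs => rw [hs, hf (s 0), hf (s 1)]
  generalize F.basisSec k p 0 = e₀
  generalize F.basisSec k p 1 = e₁
  generalize F.coord k p (s 0) 0 = a
  generalize F.coord k p (s 0) 1 = b
  generalize F.coord k p (s 1) 0 = c
  generalize F.coord k p (s 1) 1 = d
  rw [hadd, hsmul, hsmul, hswap e₀, hswap e₁ (_ + _), hadd, hadd, hsmul, hsmul, hsmul, hsmul,
    hzero, hzero, hswap e₁ e₀, smul_eq_mul]
  ring

/-- The composition `γ ∘ β` is `q`. -/
theorem heckeγ_heckeβ (hq : q.HasSimpleZeros) (y : Lines q L) (x : X) (v v' : T x)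
    (w : DetDual (heckeBundle hq y) x) :
    heckeγ hq y x v' (heckeβ hq y x v w) = q.toFun x v' v • w := by
  have hx : x ∈ patch q L x := mem_patch x
  have hx' : x ∈ (heckeBundle hq y).base x := hx
  rw [eq_smul_detForm _ hx' w, ← (tangentLine X).coord_smul_frame hx.1.2 v,
    ← (tangentLine X).coord_smul_frame hx.1.2 v']
  simp only [map_smul, LinearMap.smul_apply, smul_smul, smul_eq_mul]
  have key : heckeγ hq y x ((tangentLine X).frame x x) (heckeβ hq y x ((tangentLine X).frame x x)
      ((heckeBundle hq y).detForm x x)) = q.coeff x x • (heckeBundle hq y).detForm x x := by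
    rw [eq_smul_detForm _ hx' (heckeγ hq y x _ _)]
    congr 1
    have hβ := heckeβ_coeff hq y hx
    generalize heckeβ hq y x ((tangentLine X).frame x x)
      ((heckeBundle hq y).detForm x x) = f at hβ ⊢
    have hf : f = (-heckeFrame y x x 0 1) • (heckeBundle hq y).basisSec x x 0 +
        heckeFrame y x x 0 0 • (heckeBundle hq y).basisSec x x 1 := by
      rw [← (heckeBundle hq y).localSec_coord hx' f, hβ,
        ← (heckeBundle hq y).localSec_coord hx' (_ + _)]
      congr 1
      simp only [HolVB.basisSec, map_add, map_smul, (heckeBundle hq y).coord_localSec hx']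
      ext a
      fin_cases a <;> simp
    rw [hf, map_add, map_smul, map_smul, AlternatingMap.add_apply, AlternatingMap.smul_apply,
      AlternatingMap.smul_apply, heckeγ_coeff hq y hx, heckeγ_coeff hq y hx,
      ← det_heckeFrame y, Matrix.det_fin_two, smul_eq_mul, smul_eq_mul]
    ring
  rw [key, smul_smul]
  congr 1
  unfold QuadraticDifferential.coeff
  ring

end Hecke

section Family

variable {X : Type*} [TopologicalSpace X] [ChartedSpace ℂ X] [IsManifold 𝓘(ℂ) ω X]

/-- The automorphism `diag(c, 1)` of `V_x = (L⁻²K)_x ⊕ (LK)_x`. -/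
def torusMap (L : LineBundle X) (x : X) (c : ℂˣ) : VFiber L x ≃ₗ[ℂ] VFiber L x :=
  (LinearEquiv.smulOfUnit c).prodCongr (LinearEquiv.refl ℂ (SndFiber L x))

/-- The action `[x₀ : x₁] ↦ [c x₀ : x₁]` of `c ∈ ℂˣ` on `ℙ(V_x^*)`. -/
def torusAct {L : LineBundle X} {x : X} (c : ℂˣ) (l : PFiber L x) : PFiber L x :=
  l.map (torusMap L x c).dualMap.toLinearMap (torusMap L x c).dualMap.injective

theorem mem_torusAct {L : LineBundle X} {x : X} (c : ℂˣ) (l : PFiber L x)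
    (ξ : Module.Dual ℂ (VFiber L x)) :
    ξ ∈ (torusAct c l).submodule ↔ ∃ η ∈ l.submodule, (torusMap L x c).dualMap η = ξ := by
  induction l using Projectivization.ind with
  | h v hv =>
    simp only [torusAct, Projectivization.map_mk, Projectivization.submodule_mk,
      Submodule.mem_span_singleton]
    constructor
    · rintro ⟨a, rfl⟩
      exact ⟨a • v, ⟨a, rfl⟩, map_smul _ _ _⟩
    · rintro ⟨η, ⟨a, rfl⟩, rfl⟩
      exact ⟨a, (map_smul _ _ _).symm⟩

theorem torusAct_one {L : LineBundle X} {x : X} (l : PFiber L x) : torusAct 1 l = l := by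
  apply Projectivization.submodule_injective
  ext ξ
  have h : ∀ η, (torusMap L x 1).dualMap η = η := fun η => LinearMap.ext fun w => by
    change η ((1 : ℂˣ) • w.1, w.2) = η w
    rw [one_smul]
  simp [mem_torusAct, h]

theorem torusAct_mul {L : LineBundle X} {x : X} (c c' : ℂˣ) (l : PFiber L x) :
    torusAct (c * c') l = torusAct c (torusAct c' l) := by
  apply Projectivization.submodule_injective
  ext ξ
  have h : ∀ η, (torusMap L x (c * c')).dualMap η =
      (torusMap L x c).dualMap ((torusMap L x c').dualMap η) :=
    fun η => LinearMap.ext fun w => by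
      change η ((c * c') • w.1, w.2) = η (c' • c • w.1, w.2)
      rw [mul_comm, mul_smul]
  simp [mem_torusAct, h]

/-- The space `𝒫`: pairs of a point `p ∈ Pic^d X` and a choice of a point of
`ℙ((L⁻²K ⊕ LK)_x^*)` for each zero `x` of `q`, where `L = 𝓛 p`. -/
structure PSpace (q : QuadraticDifferential X) (d : ℤ) (𝓛 : PicD X d → LineBundle X) where
  pt : PicD X d
  lines : Lines q (𝓛 pt)

/-- The number `n₁` of components equal to `[0:1]`. -/
def n₁ {q : QuadraticDifferential X} {L : LineBundle X} (y : Lines q L) : ℕ :=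
  {x | IsZeroOne (y x)}.ncard

/-- The number `n₂` of components equal to `[1:0]`. -/
def n₂ {q : QuadraticDifferential X} {L : LineBundle X} (y : Lines q L) : ℕ :=
  {x | IsOneZero (y x)}.ncard

/-- The space `𝒴 ⊂ 𝒫`. -/
def YSpace (q : QuadraticDifferential X) (d : ℤ) (𝓛 : PicD X d → LineBundle X) : Type _ :=
  {y : PSpace q d 𝓛 // (n₁ y.lines : ℤ) < 2 * ((genus X : ℤ) - 1 + d) ∧
    (n₂ y.lines : ℤ) < 2 * ((genus X : ℤ) - 1 - d)}

variable {q : QuadraticDifferential X} {d : ℤ} {𝓛 : PicD X d → LineBundle X}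

/-- The action of `c ∈ ℂˣ` on `𝒫`, preserving the fibres over `Pic^d X`. -/
def PSpace.act (c : ℂˣ) (y : PSpace q d 𝓛) : PSpace q d 𝓛 :=
  ⟨y.pt, fun x => torusAct c (y.lines x)⟩

theorem PSpace.act_one (y : PSpace q d 𝓛) : y.act 1 = y := by
  obtain ⟨p, l⟩ := y
  exact congrArg (PSpace.mk p) (funext fun x => torusAct_one (l x))

theorem PSpace.act_mul (c c' : ℂˣ) (y : PSpace q d 𝓛) :
    y.act (c * c') = (y.act c').act c := by
  obtain ⟨p, l⟩ := y
  exact congrArg (PSpace.mk p) (funext fun x => torusAct_mul c c' (l x))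

theorem isZeroOne_torusAct {L : LineBundle X} {x : X} (c : ℂˣ) (l : PFiber L x) :
    IsZeroOne (torusAct c l) ↔ IsZeroOne l := by
  have h : ∀ (c : ℂˣ) (l : PFiber L x), IsZeroOne l → IsZeroOne (torusAct c l) := by
    intro c l hl ξ hξ w
    obtain ⟨η, hη, rfl⟩ := (mem_torusAct c l ξ).1 hξ
    exact hl η hη (c • w)
  refine ⟨fun hc => ?_, h c l⟩
  have := h c⁻¹ _ hc
  rwa [← torusAct_mul, inv_mul_cancel, torusAct_one] at this

theorem isOneZero_torusAct {L : LineBundle X} {x : X} (c : ℂˣ) (l : PFiber L x) :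
    IsOneZero (torusAct c l) ↔ IsOneZero l := by
  have h : ∀ (c : ℂˣ) (l : PFiber L x), IsOneZero l → IsOneZero (torusAct c l) := by
    intro c l hl ξ hξ w
    obtain ⟨η, hη, rfl⟩ := (mem_torusAct c l ξ).1 hξ
    have := hl η hη w
    change η (c • (0 : FstFiber L x), w) = 0
    rwa [smul_zero]
  refine ⟨fun hc => ?_, h c l⟩
  have := h c⁻¹ _ hc
  rwa [← torusAct_mul, inv_mul_cancel, torusAct_one] at this

theorem n₁_act (c : ℂˣ) (y : PSpace q d 𝓛) : n₁ (y.act c).lines = n₁ y.lines := by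
  unfold n₁ PSpace.act
  simp only [isZeroOne_torusAct]

theorem n₂_act (c : ℂˣ) (y : PSpace q d 𝓛) : n₂ (y.act c).lines = n₂ y.lines := by
  unfold n₂ PSpace.act
  simp only [isOneZero_torusAct]

/-- The `ℂˣ`-action on `𝒴`. -/
instance : MulAction ℂˣ (YSpace q d 𝓛) where
  smul c y := ⟨y.1.act c, by rw [n₁_act, n₂_act]; exact y.2⟩
  one_smul y := Subtype.ext y.1.act_one
  mul_smul c c' y := Subtype.ext (y.1.act_mul c c')

/-- The SU(1,2) Higgs bundle `(𝓕_y, β_y, γ_y)` for `y ∈ 𝒴`. -/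
def YSpace.higgs (hq : q.HasSimpleZeros) (y : YSpace q d 𝓛) : SU12Higgs X :=
  heckeHiggs hq y.1.lines

end Family

end SU12

end

/-!
An isomorphism `α : F_y → F_{y'}` of the Higgs bundles attached to `(L, ℓ)` and `(L', ℓ')` induces
an isomorphism `L ≅ Λ²F_y^* ≅ Λ²F_{y'}^* ≅ L'` (`HolVB.Iso.nonempty_lineIso`), so the two points of
`Pic^d X` agree. Once `L = L'`, the determinant of `α` in the given frames does not depend on the
frame and is a holomorphic function on a compact connected surface, hence a constant `δ ≠ 0`
(`HolVB.Iso.exists_det_matrix_eq`).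

Compatibility with `γ = ε₂` says that `ε₂ ∘ α = δ⁻¹ ε₂`. Compatibility with `β`, which is `-ε₁^t`
followed by `F^* ⊗ Λ²F ≅ F`, says that `ε₁ ∘ α = δ² ε₁`. Both together say that
`ε ∘ α = diag(δ², δ⁻¹) ∘ ε` (`HolVB.Iso.comm_iff`). Since the image of `ε` at a zero of `q` is the
kernel of the line chosen there, `diag(δ², δ⁻¹) = δ⁻¹ diag(δ³, 1)` carries one family of lines to the
other, that is, `ℓ = δ³ · ℓ'` (`exists_torusAct_of_iso`).

Conversely, every `c ∈ ℂˣ` is a cube `δ³`, and `diag(δ², δ⁻¹)` maps the kernel bundle of `c · ℓ` to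
that of `ℓ`. In the explicit frames of the kernel bundles this map has the constant matrix
`diag(δ², δ⁻¹)` again (`heckeFrame_torusAct`), so it is a holomorphic isomorphism also across the
zeros of `q` (`heckeTorusIso`), and it is compatible with the Higgs fields
(`nonempty_iso_torusAct`).
-/

namespace SU12

/-! ### Maps of holomorphic bundles in local coordinates -/

section Coordinates

variable {X : Type*} [TopologicalSpace X] [ChartedSpace ℂ X]
variable {E : Type} [NormedAddCommGroup E] [NormedSpace ℂ E]

/-- A fibrewise map given in local coordinates by a holomorphic family of linear maps is
holomorphic on total spaces. -/
theorem HolVB.contMDiff_of_coord {V W : HolVB X E} (f : ∀ x, V.Fiber x → W.Fiber x)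
    (A : X → X → E →L[ℂ] E) (U : X → Set X) (hU : ∀ k, IsOpen (U k)) (hk : ∀ k, k ∈ U k)
    (hV : ∀ k, U k ⊆ V.base k) (hW : ∀ k, U k ⊆ W.base k)
    (hA : ∀ k, ContMDiffOn 𝓘(ℂ) 𝓘(ℂ, E →L[ℂ] E) ω (A k) (U k))
    (h : ∀ k, ∀ p ∈ U k, ∀ v, W.coord k p (f p v) = A k p (V.coord k p v)) :
    ContMDiff (𝓘(ℂ).prod 𝓘(ℂ, E)) (𝓘(ℂ).prod 𝓘(ℂ, E)) ω
      (fun v : TotalSpace E V.Fiber => (⟨v.1, f v.1 v.2⟩ : TotalSpace E W.Fiber)) := by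
  intro v₀
  obtain ⟨hπ, hc⟩ := contMDiffAt_totalSpace.1
    (contMDiffAt_id (I := 𝓘(ℂ).prod 𝓘(ℂ, E)) (n := ω) (x := v₀))
  refine contMDiffAt_totalSpace.2 ⟨hπ, ?_⟩
  have hA' : ContMDiffAt 𝓘(ℂ) 𝓘(ℂ, E →L[ℂ] E) ω (A v₀.1) v₀.1 :=
    (hA v₀.1).contMDiffAt ((hU v₀.1).mem_nhds (hk v₀.1))
  have hA'' : ContMDiffAt (𝓘(ℂ).prod 𝓘(ℂ, E)) 𝓘(ℂ, E →L[ℂ] E) ω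
      (fun v : TotalSpace E V.Fiber => A v₀.1 v.1) v₀ := hA'.comp v₀ hπ
  refine (hA''.clm_apply hc).congr_of_eventuallyEq ?_
  filter_upwards [hπ.continuousAt ((hU v₀.1).mem_nhds (hk v₀.1))] with v hv
  have hv' : v.1 ∈ U v₀.1 := hv
  have := h v₀.1 v.1 hv' v.2
  rwa [W.coord_eq (hW _ hv'), V.coord_eq (hV _ hv')] at this

theorem HolVB.coord_injective (V : HolVB X E) {k p : X} (hp : p ∈ V.base k) :
    Function.Injective (V.coord k p) := fun u v h => by
  rw [← V.localSec_coord hp u, h, V.localSec_coord hp]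

/-- The image of a local section with constant coordinates under an isomorphism of bundles has
holomorphic coordinates. -/
theorem HolVB.Iso.contMDiffOn_coord {V W : HolVB X E} (a : V.Iso W) (k : X) (v : E) :
    ContMDiffOn 𝓘(ℂ) 𝓘(ℂ, E) ω (fun p => W.coord k p (a.toEquiv p (V.localSec k p v)))
      (V.base k ∩ W.base k) := by
  intro p hp
  have h1 : ContMDiffAt 𝓘(ℂ) (𝓘(ℂ).prod 𝓘(ℂ, E)) ω
      (fun p => (⟨p, V.localSec k p v⟩ : TotalSpace E V.Fiber)) p := by
    rw [Trivialization.contMDiffAt_section_iff (e := V.triv k) (hx₀ := hp.1)]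
    refine (contMDiffAt_const (c := v)).congr_of_eventuallyEq ?_
    filter_upwards [(V.isOpen_base k).mem_nhds hp.1] with p' hp'
    rw [← V.coord_eq hp', V.coord_localSec hp']
  have h2 : ContMDiffAt 𝓘(ℂ) (𝓘(ℂ).prod 𝓘(ℂ, E)) ω
      (fun p => (⟨p, a.toEquiv p (V.localSec k p v)⟩ : TotalSpace E W.Fiber)) p :=
    (a.hol.contMDiffAt (x := (⟨p, V.localSec k p v⟩ : TotalSpace E V.Fiber))).comp p h1
  rw [Trivialization.contMDiffAt_section_iff (e := W.triv k) (hx₀ := hp.2)] at h2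
  refine (h2.congr_of_eventuallyEq ?_).contMDiffWithinAt
  filter_upwards [(W.isOpen_base k).mem_nhds hp.2] with p' hp'
  exact W.coord_eq hp' _

end Coordinates

section RankTwo

variable {X : Type*} [TopologicalSpace X] [ChartedSpace ℂ X]

theorem HolVB.coord_basisSec (F : RankTwo X) {k p : X} (hp : p ∈ F.base k) (i : Fin 2) :
    F.coord k p (F.basisSec k p i) = Pi.single i 1 := F.coord_localSec hp _

theorem HolVB.detForm_basisSec (F : RankTwo X) {k p : X} (hp : p ∈ F.base k) :
    F.detForm k p (F.basisSec k p) = 1 := by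
  change Matrix.det (Matrix.of fun i => F.coord k p (F.basisSec k p i)) = 1
  simp [F.coord_basisSec hp, Matrix.det_fin_two]

/-- The matrix of an isomorphism of rank two bundles in the local frames around `k`. -/
noncomputable def HolVB.Iso.matrix {F F' : RankTwo X} (a : F.Iso F') (k p : X) :
    Matrix (Fin 2) (Fin 2) ℂ :=
  Matrix.of fun i j => F'.coord k p (a.toEquiv p (F.basisSec k p j)) i

variable {F F' : RankTwo X} (a : F.Iso F')

theorem HolVB.Iso.coord_apply {k p : X} (hp : p ∈ F.base k) (f : F.Fiber p) :
    F'.coord k p (a.toEquiv p f) = (a.matrix k p).mulVec (F.coord k p f) := by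
  have hf : f = F.coord k p f 0 • F.basisSec k p 0 + F.coord k p f 1 • F.basisSec k p 1 := by
    apply F.coord_injective hp
    simp only [map_add, map_smul, F.coord_basisSec hp]
    ext i
    fin_cases i <;> simp
  conv_lhs => rw [hf]
  ext i
  simp only [map_add, map_smul, Pi.add_apply, Pi.smul_apply, smul_eq_mul, Matrix.mulVec,
    dotProduct, Fin.sum_univ_two, HolVB.Iso.matrix, Matrix.of_apply]
  ring

theorem HolVB.Iso.contMDiffOn_matrix (k : X) (i j : Fin 2) :
    ContMDiffOn 𝓘(ℂ) 𝓘(ℂ) ω (fun p => a.matrix k p i j) (F.base k ∩ F'.base k) :=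
  contMDiffOn_pi_space.1 (a.contMDiffOn_coord k (Pi.single j 1)) i

/-- The pullback of the frame of `Λ²F'^*` is the frame of `Λ²F^*` times the determinant. -/
theorem HolVB.Iso.detForm_comp {k p : X} (hp : p ∈ F.base k) :
    (F'.detForm k p).compLinearMap (a.toEquiv p).toLinearMap =
      (a.matrix k p).det • F.detForm k p := by
  refine AlternatingMap.ext fun s => ?_
  change Matrix.det (Matrix.of fun i => F'.coord k p (a.toEquiv p (s i))) =
    _ * Matrix.det (Matrix.of fun i => F.coord k p (s i))
  simp only [a.coord_apply hp, Matrix.det_fin_two, Matrix.of_apply, Matrix.mulVec, dotProduct,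
    Fin.sum_univ_two]
  ring

theorem HolVB.Iso.det_matrix_ne_zero {k p : X} (hp : p ∈ F.base k) (hp' : p ∈ F'.base k) :
    (a.matrix k p).det ≠ 0 := by
  intro h
  have h1 := a.detForm_comp hp
  rw [h, zero_smul] at h1
  have h2 := congrArg (fun w => w fun i => (a.toEquiv p).symm (F'.basisSec k p i)) h1
  simp only [AlternatingMap.compLinearMap_apply, LinearEquiv.coe_coe, LinearEquiv.apply_symm_apply,
    AlternatingMap.zero_apply] at h2
  exact one_ne_zero ((F'.detForm_basisSec hp').symm.trans h2)

theorem HolVB.Iso.detForm_comp_symm {k p : X} (hp : p ∈ F.base k) (hp' : p ∈ F'.base k) :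
    (F.detForm k p).compLinearMap (a.toEquiv p).symm.toLinearMap =
      (a.matrix k p).det⁻¹ • F'.detForm k p := by
  have h0 := a.det_matrix_ne_zero hp hp'
  have h1 : F.detForm k p =
      (a.matrix k p).det⁻¹ • (F'.detForm k p).compLinearMap (a.toEquiv p).toLinearMap := by
    rw [a.detForm_comp hp, smul_smul, inv_mul_cancel₀ h0, one_smul]
  rw [h1]
  refine AlternatingMap.ext fun s => ?_
  simp

end RankTwo

/-! ### The Higgs field of a kernel bundle in coordinates -/

section Hecke

variable {X : Type*} [TopologicalSpace X] [ChartedSpace ℂ X] [IsManifold 𝓘(ℂ) ω X]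
variable {q : QuadraticDifferential X} {L L' : LineBundle X}

theorem HolVB.Iso.comp_symm_eq {F F' : RankTwo X} (a : F.Iso F') {k p : X} (hp : p ∈ F.base k)
    (hp' : p ∈ F'.base k) (w : DetDual F p) :
    w.compLinearMap (a.toEquiv p).symm.toLinearMap =
      (w (F.basisSec k p) * (a.matrix k p).det⁻¹) • F'.detForm k p := by
  conv_lhs => rw [eq_smul_detForm F hp w]
  rw [mul_smul, ← a.detForm_comp_symm hp hp']
  rfl

/-- In the frames around `x`, the value of `γ` at `x` is the second row of the matrix of `ε`. -/
theorem heckeγ_eq (hq : q.HasSimpleZeros) (y : Lines q L) (x : X) (v : T x)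
    (f : (heckeBundle hq y).Fiber x) :
    heckeγ hq y x v f = ((tangentLine X).coord x x v *
      (heckeFrame y x x).mulVec ((heckeBundle hq y).coord x x f) 1) •
        (heckeBundle hq y).detForm x x := by
  change L.coord x x ((eps hq y x f).2 v) • (heckeBundle hq y).detForm x x = _
  rw [eps_snd]
  refine congrArg (· • (heckeBundle hq y).detForm x x) ?_
  simp only [sndFrame, dz, LinearMap.smul_apply, LinearMap.smulRight_apply, map_smul, smul_eq_mul,
    L.coord_frame (L.mem_base x), mul_one]
  exact mul_comm _ _

/-- In the frames around `x`, the value of `β` at `x` is the first row of the matrix of `ε`, rotated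
by the identification `F^* ⊗ Λ²F ≅ F`. -/
theorem coord_heckeβ (hq : q.HasSimpleZeros) (y : Lines q L) (x : X) (v : T x)
    (w : DetDual (heckeBundle hq y) x) :
    (heckeBundle hq y).coord x x (heckeβ hq y x v w) = ((tangentLine X).coord x x v *
      w ((heckeBundle hq y).basisSec x x)) • ![-heckeFrame y x x 0 1, heckeFrame y x x 0 0] := by
  have hx : x ∈ patch q L x := mem_patch x
  rw [← heckeβ_coeff hq y hx]
  conv_lhs => rw [eq_smul_detForm (heckeBundle hq y) (k := x) (p := x) hx w,
    ← (tangentLine X).coord_smul_frame hx.1.2 v]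
  simp only [map_smul, LinearMap.smul_apply, smul_smul, mul_comm]

variable {hq : q.HasSimpleZeros} {y : Lines q L} {y' : Lines q L'}

theorem HolVB.Iso.matrix_hecke (a : (heckeBundle hq y).Iso (heckeBundle hq y')) {k p : X}
    (hp : p ∈ patch q L k) (hp' : p ∈ patch q L' k) :
    a.matrix k p = heckeTrans y' k p p * a.matrix p p * heckeTrans y p k p := by
  have h : ∀ v, (a.matrix k p).mulVec v =
      (heckeTrans y' k p p * a.matrix p p * heckeTrans y p k p).mulVec v := by
    intro v
    have h1 := a.coord_apply (k := k) (p := p) hp ((heckeBundle hq y).localSec k p v)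
    rw [(heckeBundle hq y).coord_localSec hp, heckeBundle_coord hq y' hp',
      a.coord_apply (k := p) (p := p) (mem_patch p), heckeBundle_coord_localSec hq y hp] at h1
    rw [← h1, Matrix.mulVec_mulVec, Matrix.mulVec_mulVec, mul_assoc]
  exact Matrix.toLin'.injective (LinearMap.ext h)

/-- The determinant transforms as a section of `Hom(L, L')⁻¹`, since `Λ²F ≅ L⁻¹`. In particular it is
independent of the frame if `L = L'`. -/
theorem HolVB.Iso.det_matrix_hecke (a : (heckeBundle hq y).Iso (heckeBundle hq y')) {k p : X}
    (hp : p ∈ patch q L k) (hp' : p ∈ patch q L' k) :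
    (a.matrix k p).det = (L'.trans k p p)⁻¹ * (a.matrix p p).det * (L.trans p k p)⁻¹ := by
  rw [a.matrix_hecke hp hp', Matrix.det_mul, Matrix.det_mul, det_heckeTrans y' hp' (mem_patch p),
    det_heckeTrans y (mem_patch p) hp]

theorem HolVB.Iso.contMDiffOn_det_matrix (a : (heckeBundle hq y).Iso (heckeBundle hq y')) (k : X) :
    ContMDiffOn 𝓘(ℂ) 𝓘(ℂ) ω (fun p => (a.matrix k p).det) (patch q L k ∩ patch q L' k) := by
  simp only [Matrix.det_fin_two]
  have h := a.contMDiffOn_matrix k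
  exact ((h 0 0).mul (h 1 1)).sub ((h 0 1).mul (h 1 0))

/-- A map of line bundles which in the frames around `k` is multiplication by a holomorphic
function `g k`. -/
theorem contMDiff_lineMap (hq : q.HasSimpleZeros) (L₁ L₂ : LineBundle X)
    (f : ∀ x, L₁.Fiber x → L₂.Fiber x) (g : X → X → ℂ)
    (hg : ∀ k, ContMDiffOn 𝓘(ℂ) 𝓘(ℂ) ω (g k) (patch q L₁ k ∩ patch q L₂ k))
    (h : ∀ k, ∀ p ∈ patch q L₁ k ∩ patch q L₂ k, ∀ v,
      L₂.coord k p (f p v) = g k p * L₁.coord k p v) :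
    ContMDiff (𝓘(ℂ).prod 𝓘(ℂ, ℂ)) (𝓘(ℂ).prod 𝓘(ℂ, ℂ)) ω
      (fun v : TotalSpace ℂ L₁.Fiber => (⟨v.1, f v.1 v.2⟩ : TotalSpace ℂ L₂.Fiber)) := by
  refine HolVB.contMDiff_of_coord f (fun k p => g k p • ContinuousLinearMap.id ℂ ℂ)
    (fun k => patch q L₁ k ∩ patch q L₂ k)
    (fun k => (isOpen_patch hq k).inter (isOpen_patch hq k))
    (fun k => ⟨mem_patch k, mem_patch k⟩) (fun k p hp => hp.1.1.1) (fun k p hp => hp.2.1.1)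
    (fun k => (hg k).smul contMDiffOn_const) ?_
  intro k p hp v
  rw [h k p hp v]
  rfl

/-- An isomorphism of kernel bundles induces an isomorphism of line bundles, as `Λ²F^* ≅ L`. -/
theorem HolVB.Iso.nonempty_lineIso (a : (heckeBundle hq y).Iso (heckeBundle hq y')) :
    Nonempty (L.Iso L') := by
  have hd : ∀ x, (a.matrix x x).det ≠ 0 := fun x =>
    a.det_matrix_ne_zero (k := x) (p := x) (mem_patch x) (mem_patch x)
  have hk : ∀ k, ∀ p ∈ patch q L k ∩ patch q L' k, (a.matrix k p).det ≠ 0 := fun k p hp =>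
    a.det_matrix_ne_zero (k := k) (p := p) hp.1 hp.2
  let e : ∀ x, L.Fiber x ≃ₗ[ℂ] L'.Fiber x := fun x =>
    { toFun := fun v => ((a.matrix x x).det⁻¹ * L.coord x x v) • L'.frame x x
      invFun := fun v => ((a.matrix x x).det * L'.coord x x v) • L.frame x x
      map_add' := fun u v => by rw [map_add, mul_add, add_smul]
      map_smul' := fun c v => by
        rw [map_smul, smul_eq_mul, RingHom.id_apply, smul_smul]
        congr 1
        ring
      left_inv := fun v => by
        simp only [map_smul, L'.coord_frame (L'.mem_base x), smul_eq_mul, mul_one]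
        rw [mul_inv_cancel_left₀ (hd x), L.coord_smul_frame (L.mem_base x)]
      right_inv := fun v => by
        simp only [map_smul, L.coord_frame (L.mem_base x), smul_eq_mul, mul_one]
        rw [inv_mul_cancel_left₀ (hd x), L'.coord_smul_frame (L'.mem_base x)] }
  have hcoord : ∀ k, ∀ p ∈ patch q L k ∩ patch q L' k, ∀ v,
      L'.coord k p (e p v) = (a.matrix k p).det⁻¹ * L.coord k p v := by
    intro k p hp v
    change L'.coord k p ((_ * L.coord p p v) • L'.frame p p) = _
    have h1 : L.coord p p v = L.coord k p v * L.trans p k p := by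
      conv_lhs => rw [← L.coord_smul_frame hp.1.1.1 v]
      rw [map_smul, smul_eq_mul]
      rfl
    have h2 : L'.coord k p (L'.frame p p) = L'.trans k p p := rfl
    rw [map_smul, h1, h2, a.det_matrix_hecke hp.1 hp.2, smul_eq_mul, mul_inv, mul_inv, inv_inv,
      inv_inv]
    ring
  refine ⟨⟨e, ?_, ?_⟩⟩
  · exact contMDiff_lineMap hq L L' (fun x => e x) (fun k p => (a.matrix k p).det⁻¹)
      (fun k => (a.contMDiffOn_det_matrix k).inv₀ (hk k)) hcoord
  · refine contMDiff_lineMap hq L' L (fun x => (e x).symm) (fun k p => (a.matrix k p).det)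
      (fun k => inter_comm (patch q L k) _ ▸ a.contMDiffOn_det_matrix k) fun k p hp v => ?_
    have h := hcoord k p hp.symm ((e p).symm v)
    rw [LinearEquiv.apply_symm_apply] at h
    rw [h, mul_inv_cancel_left₀ (hk k p hp.symm)]

/-- On a compact connected surface, an isomorphism between kernel bundles with the same `L` has
constant determinant. -/
theorem HolVB.Iso.exists_det_matrix_eq [CompactSpace X] [ConnectedSpace X]
    {y' : Lines q L} (a : (heckeBundle hq y).Iso (heckeBundle hq y')) :
    ∃ δ : ℂˣ, ∀ x, (a.matrix x x).det = δ := by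
  have h : MDifferentiable 𝓘(ℂ) 𝓘(ℂ) fun x => (a.matrix x x).det := by
    intro k
    have h1 : ContMDiffAt 𝓘(ℂ) 𝓘(ℂ) ω (fun p => (a.matrix k p).det) k :=
      (a.contMDiffOn_det_matrix k).contMDiffAt
        (((isOpen_patch hq k).inter (isOpen_patch hq k)).mem_nhds ⟨mem_patch k, mem_patch k⟩)
    refine (h1.congr_of_eventuallyEq ?_).mdifferentiableAt (by simp)
    filter_upwards [(isOpen_patch (L := L) hq k).mem_nhds (mem_patch k)] with p hp
    have hl : L.trans k p p * L.trans p k p = 1 := by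
      rw [L.trans_mul (L.mem_base p), L.trans_self hp.1.1]
    rw [a.det_matrix_hecke hp hp, mul_right_comm, ← mul_inv, hl, inv_one, one_mul]
  obtain ⟨δ, hδ⟩ := h.exists_eq_const_of_compactSpace
  obtain ⟨x⟩ : Nonempty X := inferInstance
  have h0 : δ ≠ 0 := by
    rw [← show (a.matrix x x).det = δ from congrFun hδ x]
    exact a.det_matrix_ne_zero (k := x) (p := x) (mem_patch x) (mem_patch x)
  exact ⟨Units.mk0 δ h0, congrFun hδ⟩

end Hecke

/-! ### Isomorphisms of Higgs bundles as diagonal maps of `V` -/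

section Diagonal

variable {X : Type*} [TopologicalSpace X] [ChartedSpace ℂ X] [IsManifold 𝓘(ℂ) ω X]
variable {q : QuadraticDifferential X} {L L' : LineBundle X}
variable {hq : q.HasSimpleZeros} {y : Lines q L} {y' : Lines q L'}

/-- The matrix in the local frames of `V = L⁻²K ⊕ LK` of the automorphism that an automorphism
`δ⁻¹` of `L` induces. -/
noncomputable def torusMatrix (δ : ℂˣ) : Matrix (Fin 2) (Fin 2) ℂ :=
  Matrix.diagonal ![(δ : ℂ) ^ 2, (δ : ℂ)⁻¹]

theorem torusMatrix_mul_inv (δ : ℂˣ) : torusMatrix δ * torusMatrix δ⁻¹ = 1 := by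
  have h := δ.ne_zero
  ext i j
  fin_cases i <;> fin_cases j <;> simp [torusMatrix, Matrix.mul_apply, Fin.sum_univ_two, h]

theorem torusMatrix_inv_mul (δ : ℂˣ) : torusMatrix δ⁻¹ * torusMatrix δ = 1 := by
  have h := torusMatrix_mul_inv δ⁻¹
  rwa [inv_inv] at h

theorem det_torusMatrix (δ : ℂˣ) : (torusMatrix δ).det = δ := by
  have h := δ.ne_zero
  simp [torusMatrix]
  field_simp

/-- Compatibility with `γ` at `x` is a relation between the second rows of the inclusions
`F → V`. -/
theorem HolVB.Iso.comm_γ_iff (a : (heckeBundle hq y).Iso (heckeBundle hq y')) (x : X) :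
    (∀ (v : T x) (f : (heckeBundle hq y).Fiber x), heckeγ hq y' x v (a.toEquiv x f) =
      (heckeγ hq y x v f).compLinearMap (a.toEquiv x).symm.toLinearMap) ↔
    ∀ u : Fin 2 → ℂ, (heckeFrame y' x x).mulVec ((a.matrix x x).mulVec u) 1 =
      (a.matrix x x).det⁻¹ * (heckeFrame y x x).mulVec u 1 := by
  have hx : x ∈ (heckeBundle hq y).base x := (heckeBundle hq y).mem_base x
  have hx' : x ∈ (heckeBundle hq y').base x := (heckeBundle hq y').mem_base x
  have hr : ∀ (v : T x) (f : (heckeBundle hq y).Fiber x),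
      (heckeγ hq y x v f).compLinearMap (a.toEquiv x).symm.toLinearMap =
      ((tangentLine X).coord x x v * ((a.matrix x x).det⁻¹ *
        (heckeFrame y x x).mulVec ((heckeBundle hq y).coord x x f) 1)) •
          (heckeBundle hq y').detForm x x := by
    intro v f
    rw [a.comp_symm_eq hx hx', heckeγ_eq, AlternatingMap.smul_apply, HolVB.detForm_basisSec _ hx,
      smul_eq_mul, mul_one, mul_assoc, mul_comm (a.matrix x x).det⁻¹]
  constructor
  · intro h u
    have h1 := h ((tangentLine X).frame x x) ((heckeBundle hq y).localSec x x u)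
    rw [hr, heckeγ_eq, a.coord_apply hx, (heckeBundle hq y).coord_localSec hx,
      (tangentLine X).coord_frame ((tangentLine X).mem_base x), one_mul, one_mul] at h1
    have h2 := congrArg (fun w => w ((heckeBundle hq y').basisSec x x)) h1
    simpa only [AlternatingMap.smul_apply, HolVB.detForm_basisSec _ hx', smul_eq_mul, mul_one]
      using h2
  · intro h v f
    rw [hr, heckeγ_eq, a.coord_apply hx, h]

/-- Compatibility with `β` at `x` is a relation between the first rows of the inclusions
`F → V`. -/
theorem HolVB.Iso.comm_β_iff (a : (heckeBundle hq y).Iso (heckeBundle hq y')) (x : X) :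
    (∀ (v : T x) (w : DetDual (heckeBundle hq y) x),
      heckeβ hq y' x v (w.compLinearMap (a.toEquiv x).symm.toLinearMap) =
        a.toEquiv x (heckeβ hq y x v w)) ↔
    (a.matrix x x).det⁻¹ • ![-heckeFrame y' x x 0 1, heckeFrame y' x x 0 0] =
      (a.matrix x x).mulVec ![-heckeFrame y x x 0 1, heckeFrame y x x 0 0] := by
  have hx : x ∈ (heckeBundle hq y).base x := (heckeBundle hq y).mem_base x
  have hx' : x ∈ (heckeBundle hq y').base x := (heckeBundle hq y').mem_base x
  have hl : ∀ (v : T x) (w : DetDual (heckeBundle hq y) x), (heckeBundle hq y').coord x x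
      (heckeβ hq y' x v (w.compLinearMap (a.toEquiv x).symm.toLinearMap)) =
      ((tangentLine X).coord x x v * w ((heckeBundle hq y).basisSec x x)) •
        ((a.matrix x x).det⁻¹ • ![-heckeFrame y' x x 0 1, heckeFrame y' x x 0 0]) := by
    intro v w
    rw [coord_heckeβ, a.comp_symm_eq hx hx', AlternatingMap.smul_apply,
      HolVB.detForm_basisSec _ hx', smul_eq_mul, mul_one, smul_smul, mul_assoc]
  constructor
  · intro h
    have h1 := congrArg ((heckeBundle hq y').coord x x)
      (h ((tangentLine X).frame x x) ((heckeBundle hq y).detForm x x))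
    rwa [hl, a.coord_apply hx, coord_heckeβ, HolVB.detForm_basisSec _ hx,
      (tangentLine X).coord_frame ((tangentLine X).mem_base x), one_mul, one_smul, one_smul] at h1
  · intro h v w
    apply (heckeBundle hq y').coord_injective hx'
    rw [hl, a.coord_apply hx, coord_heckeβ, h, Matrix.mulVec_smul]

/-- An isomorphism of kernel bundles with determinant `δ` at `x` is compatible with the Higgs fields
at `x` exactly if it extends to the map `diag(δ², δ⁻¹)` of `V`. -/
theorem HolVB.Iso.comm_iff (a : (heckeBundle hq y).Iso (heckeBundle hq y')) (x : X) (δ : ℂˣ)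
    (hδ : (a.matrix x x).det = δ) :
    ((∀ (v : T x) (w : DetDual (heckeBundle hq y) x),
      heckeβ hq y' x v (w.compLinearMap (a.toEquiv x).symm.toLinearMap) =
        a.toEquiv x (heckeβ hq y x v w)) ∧
    ∀ (v : T x) (f : (heckeBundle hq y).Fiber x), heckeγ hq y' x v (a.toEquiv x f) =
      (heckeγ hq y x v f).compLinearMap (a.toEquiv x).symm.toLinearMap) ↔
    heckeFrame y' x x * a.matrix x x = torusMatrix δ * heckeFrame y x x := by
  rw [a.comm_γ_iff, a.comm_β_iff, hδ]
  rw [Matrix.det_fin_two] at hδ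
  generalize a.matrix x x = A at hδ ⊢
  generalize heckeFrame y' x x = M'
  generalize heckeFrame y x x = M
  have h0 : (δ : ℂ) ≠ 0 := δ.ne_zero
  have hi : (δ : ℂ) * (δ : ℂ)⁻¹ = 1 := mul_inv_cancel₀ h0
  constructor
  · rintro ⟨hβ, hγ⟩
    have b0 := congrFun hβ 0
    have b1 := congrFun hβ 1
    have g0 := hγ ![1, 0]
    have g1 := hγ ![0, 1]
    simp [Matrix.mulVec, dotProduct, Fin.sum_univ_two] at b0 b1 g0 g1
    ext i j
    fin_cases i <;> fin_cases j <;>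
      simp [torusMatrix, Matrix.mul_apply, Fin.sum_univ_two]
    · linear_combination δ * A 0 0 * b1 - δ * A 1 0 * b0 + δ * M 0 0 * hδ -
        (M' 0 0 * A 0 0 + M' 0 1 * A 1 0) * hi
    · linear_combination δ * A 0 1 * b1 - δ * A 1 1 * b0 + δ * M 0 1 * hδ -
        (M' 0 0 * A 0 1 + M' 0 1 * A 1 1) * hi
    · exact g0
    · exact g1
  · intro h
    have h00 := congrFun (congrFun h 0) 0
    have h01 := congrFun (congrFun h 0) 1
    have h10 := congrFun (congrFun h 1) 0
    have h11 := congrFun (congrFun h 1) 1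
    simp [torusMatrix, Matrix.mul_apply, Fin.sum_univ_two] at h00 h01 h10 h11
    refine ⟨?_, fun u => ?_⟩
    · ext i
      fin_cases i <;> simp [Matrix.mulVec, dotProduct, Fin.sum_univ_two]
      · linear_combination (-(δ : ℂ)⁻¹ ^ 2) * (A 0 0 * h01 - A 0 1 * h00) +
          (δ : ℂ)⁻¹ ^ 2 * M' 0 1 * hδ + (δ : ℂ)⁻¹ * M' 0 1 * hi -
          (A 0 0 * M 0 1 - A 0 1 * M 0 0) * ((δ : ℂ) * (δ : ℂ)⁻¹ + 1) * hi
      · linear_combination (δ : ℂ)⁻¹ ^ 2 * (A 1 1 * h00 - A 1 0 * h01) -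
          (δ : ℂ)⁻¹ ^ 2 * M' 0 0 * hδ - (δ : ℂ)⁻¹ * M' 0 0 * hi +
          (A 1 1 * M 0 0 - A 1 0 * M 0 1) * ((δ : ℂ) * (δ : ℂ)⁻¹ + 1) * hi
    · simp [Matrix.mulVec, dotProduct, Fin.sum_univ_two]
      linear_combination u 0 * h10 + u 1 * h11

end Diagonal

/-! ### Lines and the torus action -/

section Torus

variable {X : Type*} [TopologicalSpace X] [ChartedSpace ℂ X] [IsManifold 𝓘(ℂ) ω X]
variable {q : QuadraticDifferential X} {L : LineBundle X}

/-- A line of functionals is determined by its common kernel. -/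
theorem projectivization_eq_of_ker {W : Type*} [AddCommGroup W] [Module ℂ W]
    {l l' : ℙ ℂ (Module.Dual ℂ W)}
    (h : ∀ w : W, (∀ ξ ∈ l.submodule, ξ w = 0) → ∀ ξ ∈ l'.submodule, ξ w = 0) : l = l' := by
  have hm : l'.rep ∈ Submodule.span ℂ (Set.range fun _ : Unit => l.rep) := by
    refine mem_span_of_iInf_ker_le_ker fun w hw => ?_
    have hw' : l.rep w = 0 := by simpa using hw
    refine h w (fun ξ hξ => ?_) l'.rep
      (by rw [Projectivization.submodule_eq]; exact Submodule.mem_span_singleton_self _)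
    rw [Projectivization.submodule_eq] at hξ
    obtain ⟨c, rfl⟩ := Submodule.mem_span_singleton.1 hξ
    rw [LinearMap.smul_apply, hw', smul_zero]
  rw [Set.range_const, Submodule.mem_span_singleton] at hm
  obtain ⟨c, hc⟩ := hm
  rw [← l.mk_rep, ← l'.mk_rep]
  exact ((Projectivization.mk_eq_mk_iff' ℂ _ _ l'.rep_nonzero l.rep_nonzero).2 ⟨c, hc⟩).symm

theorem torusMap_vFrameMap (k p : X) (c : ℂˣ) (u : Fin 2 → ℂ) :
    torusMap L p c (vFrameMap L k p u) = vFrameMap L k p ![c * u 0, u 1] := by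
  refine Prod.ext ?_ ?_
  · change c • (vFrameMap L k p u).1 = _
    simp [vFrameMap, Units.smul_def, mul_smul]
  · change (vFrameMap L k p u).2 = _
    simp [vFrameMap]

theorem torusMatrix_mulVec (δ : ℂˣ) (u : Fin 2 → ℂ) :
    (torusMatrix δ).mulVec u = (δ : ℂ)⁻¹ • ![((δ ^ 3 : ℂˣ) : ℂ) * u 0, u 1] := by
  have h := δ.ne_zero
  ext i
  fin_cases i
  · simp [torusMatrix, Matrix.mulVec_diagonal]
    field_simp
  · simp [torusMatrix, Matrix.mulVec_diagonal]

/-- The coordinates of `c • ℓ` are those of `ℓ`, with the first one multiplied by `c`, up to a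
common factor. -/
theorem lineCoord_torusAct (c : ℂˣ) (y : Lines q L) (k : X) : ∃ μ : ℂ, μ ≠ 0 ∧
    lineCoord (fun x => torusAct c (y x)) k =
      (μ * (c * (lineCoord y k).1), μ * (lineCoord y k).2) := by
  by_cases hk : k ∈ q.zeros
  · have hm : (torusAct c (y ⟨k, hk⟩)).rep ∈ (torusAct c (y ⟨k, hk⟩)).submodule := by
      rw [Projectivization.submodule_eq]
      exact Submodule.mem_span_singleton_self _
    obtain ⟨η, hη, hr⟩ := (mem_torusAct c _ _).1 hm
    rw [Projectivization.submodule_eq] at hη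
    obtain ⟨μ, rfl⟩ := Submodule.mem_span_singleton.1 hη
    have h1 : lineCoord (fun x => torusAct c (y x)) k =
        ((torusAct c (y ⟨k, hk⟩)).rep (fstFrame L k k, 0),
          (torusAct c (y ⟨k, hk⟩)).rep (0, sndFrame L k k)) := dif_pos hk
    have h2 : lineCoord y k = ((y ⟨k, hk⟩).rep (fstFrame L k k, 0),
        (y ⟨k, hk⟩).rep (0, sndFrame L k k)) := dif_pos hk
    refine ⟨μ, ?_, ?_⟩
    · rintro rfl
      apply (torusAct c (y ⟨k, hk⟩)).rep_nonzero
      rw [← hr, zero_smul, map_zero]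
    · rw [h1, h2, ← hr]
      refine Prod.ext ?_ ?_
      · change μ * (y ⟨k, hk⟩).rep ((c : ℂ) • fstFrame L k k, (0 : SndFiber L k)) = _
        have : ((c : ℂ) • fstFrame L k k, (0 : SndFiber L k)) =
          (c : ℂ) • (fstFrame L k k, (0 : SndFiber L k)) := by simp
        rw [this, map_smul, smul_eq_mul]
      · change μ * (y ⟨k, hk⟩).rep ((c : ℂ) • (0 : FstFiber L k), sndFrame L k k) = _
        rw [smul_zero]
  · have h : ∀ z : Lines q L, lineCoord z k = (0, 1) := fun z => dif_neg hk
    exact ⟨1, one_ne_zero, by simp [h]⟩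

/-- The inclusions into `V` of the kernel bundles of `ℓ` and `δ³ • ℓ` are intertwined by
`diag(δ², δ⁻¹)`, which has the same matrix in the frames of the kernel bundles. -/
theorem heckeFrame_torusAct (δ : ℂˣ) (y : Lines q L) (k p : X) :
    heckeFrame y k p * torusMatrix δ =
      torusMatrix δ * heckeFrame (fun x => torusAct (δ ^ 3) (y x)) k p := by
  obtain ⟨μ, hμ, h⟩ := lineCoord_torusAct (δ ^ 3) y k
  have h0 := δ.ne_zero
  unfold heckeFrame
  rw [h]
  by_cases hb : (lineCoord y k).2 = 0
  · rw [if_pos hb, if_pos (by simp [hb])]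
    ext i j
    fin_cases i <;> fin_cases j <;> simp [torusMatrix, mul_comm]
  · rw [if_neg hb, if_neg (mul_ne_zero hμ hb)]
    ext i j
    fin_cases i <;> fin_cases j <;> simp [torusMatrix, mul_comm]
    field_simp

theorem vTrans_mul_torusMatrix (δ : ℂˣ) (j k p : X) :
    vTrans L j k p * torusMatrix δ = torusMatrix δ * vTrans L j k p := by
  ext a b
  fin_cases a <;> fin_cases b <;> simp [vTrans, torusMatrix, mul_comm]

theorem heckeTrans_torusAct (δ : ℂˣ) (y : Lines q L) {j k p : X} (hj : p ∈ patch q L j)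
    (hk : p ∈ patch q L k) :
    heckeTrans y j k p * torusMatrix δ =
      torusMatrix δ * heckeTrans (fun x => torusAct (δ ^ 3) (y x)) j k p := by
  by_cases hjk : j = k
  · simp [heckeTrans, hjk]
  · have hu : IsUnit (heckeFrame y j p) := by
      rw [Matrix.isUnit_iff_isUnit_det, det_heckeFrame]
      exact (coeff_ne_zero' hj hk hjk).isUnit
    apply hu.mul_left_cancel
    rw [← mul_assoc, heckeFrame_mul_trans y hj hk, mul_assoc, heckeFrame_torusAct, ← mul_assoc,
      vTrans_mul_torusMatrix, mul_assoc, ← heckeFrame_mul_trans _ hj hk, ← mul_assoc, ← mul_assoc,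
      heckeFrame_torusAct]

end Torus

/-! ### The two implications -/

section Orbits

variable {X : Type*} [TopologicalSpace X] [ChartedSpace ℂ X] [IsManifold 𝓘(ℂ) ω X]
variable {q : QuadraticDifferential X} {L : LineBundle X}

/-- `diag(δ², δ⁻¹)` as a linear automorphism of `ℂ²`. -/
noncomputable def torusEquiv (δ : ℂˣ) : (Fin 2 → ℂ) ≃ₗ[ℂ] (Fin 2 → ℂ) :=
  Matrix.toLin'OfInv (torusMatrix_inv_mul δ) (torusMatrix_mul_inv δ)

/-- The fibre coordinate in the trivialisation around `k`, as a linear equivalence. -/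
noncomputable def HolVB.coordEquiv {E : Type} [NormedAddCommGroup E] [NormedSpace ℂ E]
    (V : HolVB X E) (k : X) : V.Fiber k ≃ₗ[ℂ] E :=
  { V.coord k k with
    invFun := V.localSec k k
    left_inv := V.localSec_coord (V.mem_base k)
    right_inv := V.coord_localSec (V.mem_base k) }

/-- The isomorphism between the kernel bundles of `δ³ • ℓ` and `ℓ` which is `diag(δ², δ⁻¹)` in all
local frames. -/
noncomputable def heckeTorusIso (hq : q.HasSimpleZeros) (δ : ℂˣ) (y : Lines q L) :
    (heckeBundle hq fun x => torusAct (δ ^ 3) (y x)).Iso (heckeBundle hq y) := by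
  let y' : Lines q L := fun x => torusAct (δ ^ 3) (y x)
  let e : ∀ x, (heckeBundle hq y').Fiber x ≃ₗ[ℂ] (heckeBundle hq y).Fiber x := fun x =>
    ((heckeBundle hq y').coordEquiv x).trans
      ((torusEquiv δ).trans ((heckeBundle hq y).coordEquiv x).symm)
  have he : ∀ x f, (heckeBundle hq y).coord x x (e x f) =
      (torusMatrix δ).mulVec ((heckeBundle hq y').coord x x f) := fun x f =>
    (heckeBundle hq y).coord_localSec (mem_patch x) _
  have hcoord : ∀ k, ∀ p ∈ patch q L k, ∀ f, (heckeBundle hq y).coord k p (e p f) =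
      (torusMatrix δ).mulVec ((heckeBundle hq y').coord k p f) := by
    intro k p hp f
    rw [heckeBundle_coord hq y hp, heckeBundle_coord hq y' hp, he, Matrix.mulVec_mulVec,
      Matrix.mulVec_mulVec, heckeTrans_torusAct δ y hp (mem_patch p)]
  refine ⟨e, ?_, ?_⟩
  · exact HolVB.contMDiff_of_coord (fun x => e x) (fun _ _ => matCLM (torusMatrix δ)) (patch q L)
      (isOpen_patch hq) mem_patch (fun k => subset_rfl) (fun k => subset_rfl)
      (fun k => contMDiffOn_const) hcoord
  · refine HolVB.contMDiff_of_coord (fun x => (e x).symm) (fun _ _ => matCLM (torusMatrix δ⁻¹))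
      (patch q L) (isOpen_patch hq) mem_patch (fun k => subset_rfl) (fun k => subset_rfl)
      (fun k => contMDiffOn_const) fun k p hp f => ?_
    have h := hcoord k p hp ((e p).symm f)
    rw [LinearEquiv.apply_symm_apply] at h
    rw [h, matCLM_apply, Matrix.mulVec_mulVec, torusMatrix_inv_mul, Matrix.one_mulVec]

theorem matrix_heckeTorusIso (hq : q.HasSimpleZeros) (δ : ℂˣ) (y : Lines q L) (x : X) :
    (heckeTorusIso hq δ y).matrix x x = torusMatrix δ := by
  ext i j
  change (heckeBundle hq y).coord x x ((heckeBundle hq y).localSec x x ((torusMatrix δ).mulVec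
    ((heckeBundle hq _).coord x x ((heckeBundle hq _).basisSec x x j)))) i = _
  rw [(heckeBundle hq y).coord_localSec (mem_patch x), HolVB.coord_basisSec _ (mem_patch x)]
  simp

theorem nonempty_iso_torusAct (hq : q.HasSimpleZeros) (c : ℂˣ) (y : Lines q L) :
    Nonempty ((heckeHiggs hq fun x => torusAct c (y x)).Iso (heckeHiggs hq y)) := by
  -- The determinant of the isomorphism is a cube root of `c`.
  obtain ⟨z, hz⟩ := IsAlgClosed.exists_pow_nat_eq (c : ℂ) (n := 3) (by norm_num)
  have hz0 : z ≠ 0 := by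
    rintro rfl
    exact c.ne_zero (by rw [← hz]; norm_num)
  obtain rfl : Units.mk0 z hz0 ^ 3 = c := Units.ext hz
  generalize Units.mk0 z hz0 = δ
  have h := fun x => ((heckeTorusIso hq δ y).comm_iff x δ
    (by rw [matrix_heckeTorusIso, det_torusMatrix])).2
    (by rw [matrix_heckeTorusIso, heckeFrame_torusAct])
  exact ⟨⟨heckeTorusIso hq δ y, fun x => (h x).1, fun x => (h x).2⟩⟩

theorem exists_torusAct_of_iso [CompactSpace X] [ConnectedSpace X] {hq : q.HasSimpleZeros}
    {y y' : Lines q L} (a : (heckeHiggs hq y).Iso (heckeHiggs hq y')) :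
    ∃ c : ℂˣ, (fun x => torusAct c (y' x)) = y := by
  let α : (heckeBundle hq y).Iso (heckeBundle hq y') := a.α
  obtain ⟨δ, hδ⟩ := α.exists_det_matrix_eq
  refine ⟨δ ^ 3, funext fun x => Eq.symm ?_⟩
  refine projectivization_eq_of_ker (W := VFiber L x.1) fun w hw => ?_
  obtain ⟨f, rfl⟩ := (eps_range hq y x w).2 hw
  have hm := (α.comm_iff x δ (hδ x)).1 ⟨a.comm_β x, a.comm_γ x⟩
  -- `diag(δ², δ⁻¹)` is a multiple of `diag(δ³, 1)`.
  have hε : eps hq y' x (α.toEquiv x f) = (δ : ℂ)⁻¹ • torusMap L x (δ ^ 3) (eps hq y x f) := by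
    change vFrameMap L x x ((heckeFrame y' x x).mulVec ((heckeBundle hq y').coord x x _)) =
      (δ : ℂ)⁻¹ • torusMap L x (δ ^ 3)
        (vFrameMap L x x ((heckeFrame y x x).mulVec ((heckeBundle hq y).coord x x f)))
    rw [α.coord_apply (mem_patch x.1), Matrix.mulVec_mulVec, hm, ← Matrix.mulVec_mulVec,
      torusMatrix_mulVec, map_smul, torusMap_vFrameMap]
  intro ξ hξ
  obtain ⟨η, hη, rfl⟩ := (mem_torusAct _ _ _).1 hξ
  have h0 := (eps_range hq y' x _).1 ⟨α.toEquiv x f, rfl⟩ η hη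
  rw [hε, map_smul, smul_eq_mul] at h0
  exact (mul_eq_zero.1 h0).resolve_left (inv_ne_zero δ.ne_zero)

end Orbits

end SU12

theorem mainTheorem5 {X : Type*} [TopologicalSpace X] [T2Space X] [CompactSpace X]
    [ConnectedSpace X] [ChartedSpace ℂ X] [IsManifold 𝓘(ℂ) ω X] (hg : 2 ≤ SU12.genus X)
    (d : ℤ) (hd : |d| < (SU12.genus X : ℤ) - 1)
    (q : SU12.QuadraticDifferential X) (hq : q.HasSimpleZeros)
    (𝓛 : SU12.PicD X d → SU12.LineBundle X) (h𝓛 : ∀ p, ⟦𝓛 p⟧ = p.1)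
    (s t : SU12.YSpace q d 𝓛) :
    Nonempty ((s.higgs hq).Iso (t.higgs hq)) ↔ s ∈ MulAction.orbit ℂˣ t := by
  constructor
  · rintro ⟨a⟩
    obtain ⟨⟨p, y⟩, hs⟩ := s
    obtain ⟨⟨p', y'⟩, ht⟩ := t
    let α : (SU12.heckeBundle hq y).Iso (SU12.heckeBundle hq y') := a.α
    obtain rfl : p = p' := by
      apply Subtype.ext
      rw [← h𝓛, ← h𝓛]
      exact Quotient.sound α.nonempty_lineIso
    obtain ⟨c, rfl⟩ := SU12.exists_torusAct_of_iso (y := y) (y' := y') a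
    exact ⟨c, rfl⟩
  · rintro ⟨c, rfl⟩
    exact SU12.nonempty_iso_torusAct hq c t.1.lines
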